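/- Let $n\ge 1$, let $\Omega=\{\tau=(\tau_1,\tilde\tau)\in\mathbb C\times\mathbb C^{n-1}:\operatorname{Im}\tau_1>|\tilde\tau|^2\}$, and for real $\alpha$ put $\gamma_\alpha(\tau)=(\operatorname{Im}\tau_1-|\tilde\tau|^2)^\alpha$, $\tau\in\Omega$. Let $m$ be Lebesgue measure on $\mathbb C^n=\mathbb R^{2n}$. For $z,w\in\Omega$ and $\beta>0$ let $$B_\beta(z,w)=\Bigl(i(\overline{w_1}-z_1)-2\sum_{j=2}^n z_j\overline{w_j}\Bigr)^{-\beta-n-1},$$ where the base has positive real part and the principal branch is taken. Let $\nu>-1$ and $t=\frac{\nu+n+1}{2}$. Let $A^\infty_t(\Omega)$ be the space of holomorphic $f$ on $\Omega$ with $\|f\|_{A^\infty_t}=\sup_{\Omega}|f|\gamma_t<\infty$, and $A^2_\nu(\Omega)$ the space of holomorphic $g$ on $\Omega$ with $\int_\Omega|g|^2\gamma_\nu\,dm<\infty$. For $f\in A^\infty_t(\Omega)$ and $\epsilon>0$ put $N_{\epsilon,t}(f)=\{z\in\Omega:|f(z)|\gamma_t(z)\ge\epsilon\}$, $$l_1(f)=\operatorname{dist}_{A^\infty_t}(f,A^2_\nu)=\inf_{g\in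 A^2_\nu(\Omega)}\|f-g\|_{A^\infty_t},$$ $$l_2(f)=\inf\Bigl\{\epsilon>0:\int_\Omega\Bigl(\int_{N_{\epsilon,t}(f)}\gamma_{\beta-t}(w)\,|B_\beta(z,w)|\,dm(w)\Bigr)^2\gamma_\nu(z)\,dm(z)<\infty\Bigr\}.$$ Then there is $\beta_0>0$, depending only on $n$ and $\nu$, such that for every $\beta>\beta_0$ there are constants $c,C>0$, depending only on $n,\nu,\beta$, with $$c\,l_2(f)\le l_1(f)\le C\,l_2(f)\qquad\text{for all } f\in A^\infty_t(\Omega).$$ -/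

import Mathlib

open MeasureTheory
open scoped ENNReal ComplexConjugate

/-- The defining function `Im τ₁ - |τ̃|²`, where `τ̃ = (τ₂, …, τₙ)`.
The coordinate `τ₁` is the one with index `0 : Fin n`. -/
noncomputable def siegelRho {n : ℕ} [NeZero n] (τ : Fin n → ℂ) : ℝ :=
  (τ 0).im - ∑ j ∈ Finset.univ.erase (0 : Fin n), ‖τ j‖ ^ 2

/-- The Siegel domain `Ω = {τ ∈ ℂⁿ : Im τ₁ > |τ̃|²}`. -/
def siegelDomain (n : ℕ) [NeZero n] : Set (Fin n → ℂ) :=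
  {τ | ∑ j ∈ Finset.univ.erase (0 : Fin n), ‖τ j‖ ^ 2 < (τ 0).im}

/-- The weight `γ_α(τ) = (Im τ₁ - |τ̃|²)^α`. -/
noncomputable def siegelWeight {n : ℕ} [NeZero n] (α : ℝ) (τ : Fin n → ℂ) : ℝ :=
  siegelRho τ ^ α

/-- The expression `i (w̄₁ - z₁) - 2 ⟨z̃, w̃⟩`, with `⟨z̃, w̃⟩ = ∑_{j ≥ 2} z_j w̄_j`.
For `z, w ∈ Ω` its real part is positive. -/
noncomputable def siegelForm {n : ℕ} [NeZero n] (z w : Fin n → ℂ) : ℂ :=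
  Complex.I * (conj (w 0) - z 0) - 2 * ∑ j ∈ Finset.univ.erase (0 : Fin n), z j * conj (w j)

/-- The Bergman kernel `B_β(z, w) = (i (w̄₁ - z₁) - 2 ⟨z̃, w̃⟩)^(-(β + n + 1))` (principal branch),
abbreviated `(z - w̄)^(-β - n - 1)`. It is holomorphic in `z` and antiholomorphic in `w`. -/
noncomputable def siegelKernel {n : ℕ} [NeZero n] (β : ℝ) (z w : Fin n → ℂ) : ℂ :=
  siegelForm z w ^ ((-(β + (n : ℝ) + 1) : ℝ) : ℂ)

/-- The weighted sup-norm `‖F‖_{A^∞_t} = sup_{z ∈ Ω} |F(z)| γ_t(z)`, with values in `[0, ∞]`. -/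
noncomputable def siegelSupNorm {n : ℕ} [NeZero n] (t : ℝ) (F : (Fin n → ℂ) → ℂ) : ℝ≥0∞ :=
  ⨆ z ∈ siegelDomain n, ‖F z‖ₑ * ENNReal.ofReal (siegelWeight t z)

/-- The space `A^∞_t(Ω)`: holomorphic functions on `Ω` with finite weighted sup-norm.
Values outside `Ω` play no role. -/
def SiegelAInfty (n : ℕ) [NeZero n] (t : ℝ) : Set ((Fin n → ℂ) → ℂ) :=
  {F | DifferentiableOn ℂ F (siegelDomain n) ∧ siegelSupNorm t F < ∞}

/-- The weighted Bergman space `A²_ν(Ω)`: holomorphic functions on `Ω` with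
`∫_Ω |F|² γ_ν dm < ∞`. -/
def SiegelBergman (n : ℕ) [NeZero n] (ν : ℝ) : Set ((Fin n → ℂ) → ℂ) :=
  {F | DifferentiableOn ℂ F (siegelDomain n) ∧
    ∫⁻ z in siegelDomain n, ‖F z‖ₑ ^ 2 * ENNReal.ofReal (siegelWeight ν z) < ∞}

/-- `N_{ε,s}(f) = {z ∈ Ω : |f(z)| γ_s(z) ≥ ε}`. -/
def siegelLevelSet {n : ℕ} [NeZero n] (ε s : ℝ) (f : (Fin n → ℂ) → ℂ) : Set (Fin n → ℂ) :=
  {z | z ∈ siegelDomain n ∧ ε ≤ ‖f z‖ * siegelWeight s z}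

/-- `l₁(f) = dist_{A^∞_t}(f, A²_ν) = inf {‖f - g‖_{A^∞_t} : g ∈ A²_ν(Ω)}`. -/
noncomputable def siegelL1 {n : ℕ} [NeZero n] (t ν : ℝ) (f : (Fin n → ℂ) → ℂ) : ℝ≥0∞ :=
  ⨅ g ∈ SiegelBergman n ν, siegelSupNorm t (fun z => f z - g z)

/-- The double integral
`∫_Ω (∫_{N_{ε,t}(f)} γ_{β-t}(w) |B_β(z, w)| dm(w))² γ_ν(z) dm(z)`, with values in `[0, ∞]`. -/
noncomputable def siegelG {n : ℕ} [NeZero n] (t ν β ε : ℝ) (f : (Fin n → ℂ) → ℂ) : ℝ≥0∞ :=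
  ∫⁻ z in siegelDomain n,
    (∫⁻ w in siegelLevelSet ε t f,
      ENNReal.ofReal (siegelWeight (β - t) w) * ‖siegelKernel β z w‖ₑ) ^ 2
    * ENNReal.ofReal (siegelWeight ν z)

/-- `l₂(f)`: the infimum of the `ε > 0` for which the double integral is finite. -/
noncomputable def siegelL2 {n : ℕ} [NeZero n] (t ν β : ℝ) (f : (Fin n → ℂ) → ℂ) : ℝ≥0∞ :=
  ⨅ ε ∈ {ε : ℝ | 0 < ε ∧ siegelG t ν β ε f < ∞}, ENNReal.ofReal ε

/-! ### Affine homogeneity of the Siegel domain and the polarised defining function. -/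

section Geometry

variable {n : ℕ} [NeZero n]

/-! Everything rests on two facts about the kernel. The Forelli–Rudin identity says that, for `-1 <
s < β`, the integral of `γ_s |B_β(z, ·)|` equals a finite constant times `γ_{s-β}(z)`. The
reproducing formula says that `∫ f γ_β B_β(z, ·) = M f(z)` with `M > 0`, for holomorphic `f` making
the integrand integrable.

For `l₁ ≤ C l₂`, take `ε` admissible in `l₂` and split the reproducing integral of `f` over `N =
N_{ε,t}(f)` and its complement. The part over `N`, divided by `M`, is the approximant `g`: it is
holomorphic by differentiation under the integral sign, and since `|f| ≤ ‖f‖ γ_{-t}`, finiteness of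
the double integral puts it in `A²_ν`. On the complement `|f| < ε γ_{-t}`, so Forelli–Rudin with `s
= β - t` gives `|f - g| ≤ C ε γ_{-t}` (`exists_siegelL1_le`).

For `l₂ ≤ l₁`, let `g ∈ A²_ν` with `δ = ‖f - g‖ < ε`. On `N` one has `|g| γ_t ≥ ε - δ`, so `γ_{β-t}`
is dominated there by a multiple of `γ_β |g|`. The double integral is then controlled by the
`L²(γ_ν)` norm of the positive Bergman operator applied to `|g|`, which Schur's test makes finite
(`siegelL2_le_siegelL1`).

Both kernel facts are reduced to the base point `(i, 0)` by affine automorphisms, which multiply the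
base of the kernel by `ρ(z)`. There the kernel depends on `w₁` alone. For the reproducing formula,
the mean value property in the remaining variables leaves an integral over the upper half plane; the
Cayley transform turns it into a holomorphic function times a radial weight on the disc, and the
mean value property applies again. -/

theorem mem_siegelDomain_iff {z : Fin n → ℂ} : z ∈ siegelDomain n ↔ 0 < siegelRho z := by
  simp [siegelDomain, siegelRho]

@[fun_prop]
theorem continuous_siegelRho : Continuous (siegelRho : (Fin n → ℂ) → ℝ) := by
  unfold siegelRho
  fun_prop

theorem isOpen_siegelDomain : IsOpen (siegelDomain n) := by
  have : siegelDomain n = siegelRho ⁻¹' Set.Ioi 0 := by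
    ext z; simp [mem_siegelDomain_iff]
  rw [this]
  exact isOpen_Ioi.preimage continuous_siegelRho

theorem measurableSet_siegelDomain : MeasurableSet (siegelDomain n) :=
  isOpen_siegelDomain.measurableSet

@[fun_prop]
theorem measurable_siegelWeight (α : ℝ) :
    Measurable (siegelWeight α : (Fin n → ℂ) → ℝ) := by
  unfold siegelWeight
  exact continuous_siegelRho.measurable.pow_const α

theorem siegelWeight_pos {z : Fin n → ℂ} (hz : z ∈ siegelDomain n) (α : ℝ) :
    0 < siegelWeight α z :=
  Real.rpow_pos_of_pos (mem_siegelDomain_iff.1 hz) α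

theorem siegelWeight_add {z : Fin n → ℂ} (hz : z ∈ siegelDomain n) (α β : ℝ) :
    siegelWeight (α + β) z = siegelWeight α z * siegelWeight β z :=
  Real.rpow_add (mem_siegelDomain_iff.1 hz) α β

theorem continuous_siegelForm_uncurry :
    Continuous (fun p : (Fin n → ℂ) × (Fin n → ℂ) => siegelForm p.1 p.2) := by
  unfold siegelForm
  fun_prop

theorem measurable_siegelKernel_uncurry (β : ℝ) :
    Measurable (fun p : (Fin n → ℂ) × (Fin n → ℂ) => siegelKernel β p.1 p.2) := by
  unfold siegelKernel
  exact continuous_siegelForm_uncurry.measurable.pow_const _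

theorem measurable_siegelKernel_right (β : ℝ) (z : Fin n → ℂ) :
    Measurable (fun w => siegelKernel β z w) := by
  have h : Continuous (fun w => siegelForm z w) := by
    unfold siegelForm
    fun_prop
  unfold siegelKernel
  exact h.measurable.pow_const _

theorem siegelForm_self (z : Fin n → ℂ) : siegelForm z z = ((2 * siegelRho z : ℝ) : ℂ) := by
  have h : ∀ j, z j * conj (z j) = ((‖z j‖ ^ 2 : ℝ) : ℂ) := fun j => by
    rw [Complex.mul_conj, Complex.normSq_eq_norm_sq]
  simp only [siegelForm, siegelRho, h]
  rw [← Complex.ofReal_sum]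
  apply Complex.ext <;> simp <;> ring

theorem conj_siegelForm (z w : Fin n → ℂ) : conj (siegelForm z w) = siegelForm w z := by
  simp only [siegelForm, map_sub, map_mul, map_sum, Complex.conj_I, Complex.conj_conj,
    Complex.conj_ofNat]
  congr 1
  · ring
  · simp only [mul_comm]

theorem norm_siegelForm_comm (z w : Fin n → ℂ) : ‖siegelForm z w‖ = ‖siegelForm w z‖ := by
  rw [← conj_siegelForm, RCLike.norm_conj]

/-- Polarisation of `|z_j - w_j|²`. It keeps the base of the power off the branch cut, and the sum
of squares later absorbs the growth of the `z`-derivative in `w`. -/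
theorem siegelForm_re (z w : Fin n → ℂ) :
    (siegelForm z w).re = siegelRho z + siegelRho w +
      ∑ j ∈ Finset.univ.erase (0 : Fin n), ‖z j - w j‖ ^ 2 := by
  have h : ∀ j, ‖z j - w j‖ ^ 2 = ‖z j‖ ^ 2 + ‖w j‖ ^ 2 - 2 * (z j * conj (w j)).re := fun j => by
    simp only [← Complex.normSq_eq_norm_sq, Complex.normSq_apply]
    simp
    ring
  simp only [h, siegelForm, siegelRho, Finset.sum_sub_distrib, Finset.sum_add_distrib,
    ← Finset.mul_sum]
  simp only [Complex.sub_re, Complex.mul_re, Complex.I_re, Complex.I_im, Complex.sub_im,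
    Complex.conj_im, Complex.re_ofNat, Complex.im_ofNat, Complex.re_sum, Complex.conj_re]
  ring

theorem siegelForm_re_ge {z w : Fin n → ℂ} : siegelRho z + siegelRho w ≤ (siegelForm z w).re := by
  rw [siegelForm_re]
  exact le_add_of_nonneg_right (Finset.sum_nonneg fun _ _ => sq_nonneg _)

theorem siegelForm_re_pos {z w : Fin n → ℂ} (hz : z ∈ siegelDomain n) (hw : w ∈ siegelDomain n) :
    0 < (siegelForm z w).re :=
  (add_pos (mem_siegelDomain_iff.1 hz) (mem_siegelDomain_iff.1 hw)).trans_le siegelForm_re_ge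

theorem norm_siegelKernel (β : ℝ) (z w : Fin n → ℂ) :
    ‖siegelKernel β z w‖ = ‖siegelForm z w‖ ^ (-(β + n + 1)) := by
  rw [siegelKernel, Complex.norm_cpow_real]

theorem enorm_siegelKernel_comm (β : ℝ) (z w : Fin n → ℂ) :
    ‖siegelKernel β z w‖ₑ = ‖siegelKernel β w z‖ₑ := by
  rw [← ofReal_norm, ← ofReal_norm, norm_siegelKernel, norm_siegelKernel, norm_siegelForm_comm]

/-- The linear part of the affine automorphism of the Siegel domain moving `(i, 0)` to `z`. -/
noncomputable def siegelMatrix (z : Fin n → ℂ) : Matrix (Fin n) (Fin n) ℂ :=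
  Matrix.of fun i j =>
    if i = 0 then
      if j = 0 then (siegelRho z : ℂ) else 2 * Complex.I * (√(siegelRho z) : ℝ) * conj (z j)
    else if i = j then ((√(siegelRho z) : ℝ) : ℂ) else 0

/-- The affine automorphism of the Siegel domain moving `(i, 0)` to `z`. -/
noncomputable def siegelMap (z u : Fin n → ℂ) : Fin n → ℂ :=
  Matrix.mulVec (siegelMatrix z) u + Function.update z 0 (z 0 - Complex.I * siegelRho z)

theorem siegelMap_zero (z u : Fin n → ℂ) :
    siegelMap z u 0 = siegelRho z * u 0 + 2 * Complex.I * (√(siegelRho z) : ℝ) *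
      ∑ j ∈ Finset.univ.erase (0 : Fin n), u j * conj (z j) + z 0 - Complex.I * siegelRho z := by
  simp only [siegelMap, Pi.add_apply, Function.update_self, Matrix.mulVec, dotProduct,
    siegelMatrix, Matrix.of_apply, if_true]
  rw [← Finset.add_sum_erase _ _ (Finset.mem_univ (0 : Fin n)), Finset.mul_sum]
  rw [if_pos rfl, add_sub_assoc]
  congr 2
  refine Finset.sum_congr rfl fun j hj => ?_
  rw [if_neg (Finset.ne_of_mem_erase hj)]
  ring

theorem siegelMap_of_ne (z u : Fin n → ℂ) {j : Fin n} (hj : j ≠ 0) :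
    siegelMap z u j = (√(siegelRho z) : ℝ) * u j + z j := by
  simp [siegelMap, Matrix.mulVec, dotProduct, siegelMatrix, hj]

/-- The cross terms created by translating the last coordinates by `z̃` cancel against the shear in
the first coordinate. The constant terms give `siegelForm z z = 2ρ(z)`, which the shift by `-iρ(z)`
removes. -/
theorem siegelForm_siegelMap {z : Fin n → ℂ} (hz : z ∈ siegelDomain n) (u v : Fin n → ℂ) :
    siegelForm (siegelMap z u) (siegelMap z v) = siegelRho z * siegelForm u v := by
  have hs : ((√(siegelRho z) : ℝ) : ℂ) * ((√(siegelRho z) : ℝ) : ℂ) = siegelRho z := by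
    rw [← Complex.ofReal_mul, Real.mul_self_sqrt (mem_siegelDomain_iff.1 hz).le]
  have hsum : ∑ j ∈ Finset.univ.erase (0 : Fin n), siegelMap z u j * conj (siegelMap z v j) =
      siegelRho z * ∑ j ∈ Finset.univ.erase (0 : Fin n), u j * conj (v j)
      + (√(siegelRho z) : ℝ) * ∑ j ∈ Finset.univ.erase (0 : Fin n), u j * conj (z j)
      + (√(siegelRho z) : ℝ) * ∑ j ∈ Finset.univ.erase (0 : Fin n), z j * conj (v j)
      + ∑ j ∈ Finset.univ.erase (0 : Fin n), z j * conj (z j) := by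
    simp only [Finset.mul_sum, ← Finset.sum_add_distrib]
    refine Finset.sum_congr rfl fun j hj => ?_
    rw [siegelMap_of_ne _ _ (Finset.ne_of_mem_erase hj),
      siegelMap_of_ne _ _ (Finset.ne_of_mem_erase hj), ← hs]
    simp only [map_add, map_mul, Complex.conj_ofReal]
    ring
  have hself := siegelForm_self z
  have hc : conj (∑ j ∈ Finset.univ.erase (0 : Fin n), v j * conj (z j)) =
      ∑ j ∈ Finset.univ.erase (0 : Fin n), z j * conj (v j) := by
    simp only [map_sum, map_mul, Complex.conj_conj, mul_comm]
  simp only [siegelForm] at hself ⊢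
  rw [hsum, siegelMap_zero, siegelMap_zero]
  simp only [map_add, map_sub, map_mul, Complex.conj_ofReal, Complex.conj_I, Complex.conj_ofNat, hc]
  push_cast at hself
  linear_combination hself + 2 * (√(siegelRho z) : ℝ) * (-Complex.I_sq)
    * (∑ j ∈ Finset.univ.erase (0 : Fin n), u j * conj (z j)
      + ∑ j ∈ Finset.univ.erase (0 : Fin n), z j * conj (v j))
    + 2 * siegelRho z * Complex.I_sq

theorem siegelRho_siegelMap {z : Fin n → ℂ} (hz : z ∈ siegelDomain n) (u : Fin n → ℂ) :
    siegelRho (siegelMap z u) = siegelRho z * siegelRho u := by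
  have h := siegelForm_siegelMap hz u u
  rw [siegelForm_self, siegelForm_self, ← Complex.ofReal_mul, Complex.ofReal_inj] at h
  linarith

theorem siegelMap_mem_iff {z : Fin n → ℂ} (hz : z ∈ siegelDomain n) {u : Fin n → ℂ} :
    siegelMap z u ∈ siegelDomain n ↔ u ∈ siegelDomain n := by
  rw [mem_siegelDomain_iff, mem_siegelDomain_iff, siegelRho_siegelMap hz,
    mul_pos_iff_of_pos_left (mem_siegelDomain_iff.1 hz)]

/-- The base point `(i, 0)` of the Siegel domain. -/
noncomputable def siegelBase (n : ℕ) [NeZero n] : Fin n → ℂ := Pi.single 0 Complex.I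

theorem siegelRho_siegelBase : siegelRho (siegelBase n) = 1 := by
  have : ∑ j ∈ Finset.univ.erase (0 : Fin n), ‖siegelBase n j‖ ^ 2 = 0 :=
    Finset.sum_eq_zero fun j hj => by simp [siegelBase, Finset.ne_of_mem_erase hj]
  rw [siegelRho, this]
  simp [siegelBase]

theorem siegelMap_siegelBase (z : Fin n → ℂ) : siegelMap z (siegelBase n) = z := by
  ext j
  by_cases hj : j = 0
  · subst hj
    rw [siegelMap_zero, Finset.sum_eq_zero fun j hj => by
      simp [siegelBase, Finset.ne_of_mem_erase hj]]
    simp [siegelBase]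
    ring
  · rw [siegelMap_of_ne _ _ hj]
    simp [siegelBase, hj]

theorem siegelForm_siegelBase (w : Fin n → ℂ) :
    siegelForm (siegelBase n) w = 1 + Complex.I * conj (w 0) := by
  rw [siegelForm, Finset.sum_eq_zero fun j hj => by
      simp [siegelBase, Finset.ne_of_mem_erase hj]]
  simp [siegelBase, mul_sub]
  ring

theorem det_siegelMatrix (z : Fin n → ℂ) :
    (siegelMatrix z).det = (siegelRho z : ℂ) * ((√(siegelRho z) : ℝ) : ℂ) ^ (n - 1) := by
  rw [Matrix.det_of_isUpperTriangular]
  · rw [← Finset.mul_prod_erase _ _ (Finset.mem_univ (0 : Fin n)),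
      Finset.prod_congr rfl fun j hj => (by
        simp [siegelMatrix, Finset.ne_of_mem_erase hj] :
          siegelMatrix z j j = ((√(siegelRho z) : ℝ) : ℂ))]
    simp [siegelMatrix]
  · intro i j hij
    have h0 : i ≠ 0 := by
      rintro rfl
      exact absurd hij (by simp)
    have : i ≠ j := ne_of_gt hij
    simp [siegelMatrix, h0, this]

end Geometry

/-! ### Jacobian of the automorphisms and covariance of weight and kernel. -/

section ChangeOfVariables

variable {n : ℕ} [NeZero n]

theorem norm_det_siegelMatrix_sq {z : Fin n → ℂ} (hz : z ∈ siegelDomain n) :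
    ‖(siegelMatrix z).det‖ ^ 2 = siegelRho z ^ (n + 1) := by
  have h0 := (mem_siegelDomain_iff.1 hz).le
  rw [det_siegelMatrix, norm_mul, norm_pow, Complex.norm_real, Complex.norm_real,
    Real.norm_of_nonneg h0, Real.norm_of_nonneg (Real.sqrt_nonneg _), mul_pow, ← pow_mul, mul_comm _ 2,
    pow_mul, Real.sq_sqrt h0, ← pow_add]
  congr 1
  have := NeZero.pos n
  omega

/-- The real linear part of `siegelMap z`. -/
noncomputable def siegelLinear (z : Fin n → ℂ) : (Fin n → ℂ) →L[ℝ] (Fin n → ℂ) :=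
  (LinearMap.toContinuousLinearMap (Matrix.toLin' (siegelMatrix z))).restrictScalars ℝ

theorem abs_det_siegelLinear {z : Fin n → ℂ} (hz : z ∈ siegelDomain n) :
    |(siegelLinear z).det| = siegelRho z ^ (n + 1) := by
  have : (siegelLinear z).det =
      ((Matrix.toLin' (siegelMatrix z)).restrictScalars ℝ).det := rfl
  rw [this, LinearMap.det_restrictScalars, LinearMap.det_toLin', Algebra.norm_complex_eq]
  change |Complex.normSq (siegelMatrix z).det| = _
  rw [Complex.normSq_eq_norm_sq, norm_det_siegelMatrix_sq hz]
  exact abs_of_nonneg (pow_nonneg (mem_siegelDomain_iff.1 hz).le _)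

theorem hasFDerivAt_siegelMap (z u : Fin n → ℂ) :
    HasFDerivAt (siegelMap z) (siegelLinear z) u :=
  (siegelLinear z).hasFDerivAt.add_const _

theorem differentiable_siegelMap (z : Fin n → ℂ) : Differentiable ℂ (siegelMap z) := by
  have : Differentiable ℂ (LinearMap.toContinuousLinearMap (Matrix.toLin' (siegelMatrix z))) :=
    ContinuousLinearMap.differentiable _
  exact this.add_const _

theorem siegelMap_bijective {z : Fin n → ℂ} (hz : z ∈ siegelDomain n) :
    Function.Bijective (siegelMap z) := by
  have hdet : IsUnit (siegelMatrix z) := by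
    rw [Matrix.isUnit_iff_isUnit_det, isUnit_iff_ne_zero, ← norm_ne_zero_iff,
      ← pow_ne_zero_iff two_ne_zero, norm_det_siegelMatrix_sq hz]
    exact pow_ne_zero _ (mem_siegelDomain_iff.1 hz).ne'
  exact (Equiv.addRight _).bijective.comp
    ⟨Matrix.mulVec_injective_iff_isUnit.2 hdet, Matrix.mulVec_surjective_iff_isUnit.2 hdet⟩

theorem siegelMap_image {z : Fin n → ℂ} (hz : z ∈ siegelDomain n) :
    siegelMap z '' siegelDomain n = siegelDomain n := by
  ext w
  constructor
  · rintro ⟨u, hu, rfl⟩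
    exact (siegelMap_mem_iff hz).2 hu
  · intro hw
    obtain ⟨u, rfl⟩ := (siegelMap_bijective hz).2 w
    exact ⟨u, (siegelMap_mem_iff hz).1 hw, rfl⟩

theorem lintegral_siegelMap {z : Fin n → ℂ} (hz : z ∈ siegelDomain n) (g : (Fin n → ℂ) → ℝ≥0∞) :
    ∫⁻ w in siegelDomain n, g w =
      ∫⁻ u in siegelDomain n, ENNReal.ofReal (siegelRho z ^ (n + 1)) * g (siegelMap z u) := by
  conv_lhs => rw [← siegelMap_image hz]
  rw [lintegral_image_eq_lintegral_abs_det_fderiv_mul volume measurableSet_siegelDomain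
    (fun u _ => (hasFDerivAt_siegelMap z u).hasFDerivWithinAt) (siegelMap_bijective hz).1.injOn,
    abs_det_siegelLinear hz]

theorem siegelWeight_siegelMap {z u : Fin n → ℂ} (hz : z ∈ siegelDomain n)
    (hu : u ∈ siegelDomain n) (α : ℝ) :
    siegelWeight α (siegelMap z u) = siegelWeight α z * siegelWeight α u := by
  rw [siegelWeight, siegelRho_siegelMap hz, Real.mul_rpow (mem_siegelDomain_iff.1 hz).le
    (mem_siegelDomain_iff.1 hu).le]
  rfl

/-- The principal power is multiplicative when one factor is a positive real, so no condition on `u`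
and `v` is needed; a vanishing base is treated apart. -/
theorem siegelKernel_siegelMap {z : Fin n → ℂ} (hz : z ∈ siegelDomain n) (β : ℝ)
    (u v : Fin n → ℂ) :
    siegelKernel β (siegelMap z u) (siegelMap z v) =
      (siegelWeight (-(β + n + 1)) z : ℂ) * siegelKernel β u v := by
  have h0 := mem_siegelDomain_iff.1 hz
  rw [siegelKernel, siegelForm_siegelMap hz]
  by_cases h : siegelForm u v = 0
  · rw [siegelKernel, h, mul_zero]
    by_cases h' : -(β + n + 1) = 0
    · simp [siegelWeight, h']
    · rw [Complex.zero_cpow (by exact_mod_cast h'), mul_zero]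
  rw [Complex.cpow_def_of_ne_zero (mul_ne_zero (by exact_mod_cast h0.ne') h),
    Complex.log_ofReal_mul h0 h, add_mul, Complex.exp_add, siegelKernel,
    Complex.cpow_def_of_ne_zero h, siegelWeight, Real.rpow_def_of_pos h0]
  push_cast
  rfl

/-- Homogeneity: the Jacobian, weight and kernel contribute `ρ(z)` to the powers `n + 1`, `s` and
`-(β + n + 1)`. It is an identity in `[0, ∞]`, so convergence has to be checked only at the base
point. -/
theorem lintegral_weight_mul_kernel_eq {z : Fin n → ℂ} (hz : z ∈ siegelDomain n) (s β : ℝ) :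
    ∫⁻ w in siegelDomain n, ENNReal.ofReal (siegelWeight s w) * ‖siegelKernel β z w‖ₑ =
      ENNReal.ofReal (siegelWeight (s - β) z) * ∫⁻ u in siegelDomain n,
        ENNReal.ofReal (siegelWeight s u) * ‖siegelKernel β (siegelBase n) u‖ₑ := by
  rw [lintegral_siegelMap hz, ← lintegral_const_mul' _ _ ENNReal.ofReal_ne_top]
  refine setLIntegral_congr_fun measurableSet_siegelDomain fun u hu => ?_
  have h0 := mem_siegelDomain_iff.1 hz
  have hk : ‖siegelKernel β z (siegelMap z u)‖ =
      siegelWeight (-(β + n + 1)) z * ‖siegelKernel β (siegelBase n) u‖ := by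
    have h := siegelKernel_siegelMap hz β (siegelBase n) u
    rw [siegelMap_siegelBase] at h
    rw [h, norm_mul, Complex.norm_real,
      Real.norm_of_nonneg (siegelWeight_pos hz _).le]
  have hw : siegelRho z ^ (n + 1) * siegelWeight s z * siegelWeight (-(β + n + 1)) z =
      siegelWeight (s - β) z := by
    simp only [siegelWeight]
    rw [← Real.rpow_natCast, ← Real.rpow_add h0, ← Real.rpow_add h0]
    congr 1
    push_cast
    ring
  rw [siegelWeight_siegelMap hz hu, ← ofReal_norm, hk, ← ofReal_norm, ← hw,
    ← ENNReal.ofReal_mul (mul_pos (siegelWeight_pos hz s) (siegelWeight_pos hu s)).le,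
    ← ENNReal.ofReal_mul (siegelWeight_pos hu s).le,
    ← ENNReal.ofReal_mul (pow_pos h0 _).le, ← ENNReal.ofReal_mul]
  · congr 1
    ring
  · rw [hw]; exact (siegelWeight_pos hz _).le

end ChangeOfVariables

/-! ### Slicing off the first coordinate, and convergence of the Forelli–Rudin integral. -/

section Slices

variable {k : ℕ}

theorem siegelRho_cons (a : ℂ) (v : Fin k → ℂ) :
    siegelRho (Fin.cons a v : Fin (k + 1) → ℂ) = a.im - ∑ i, ‖v i‖ ^ 2 := by
  have h := Finset.add_sum_erase Finset.univ
    (fun j => ‖(Fin.cons a v : Fin (k + 1) → ℂ) j‖ ^ 2) (Finset.mem_univ 0)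
  rw [Fin.sum_univ_succ] at h
  simp only [Fin.cons_zero, Fin.cons_succ, add_right_inj] at h
  simp only [siegelRho, h, Fin.cons_zero]

theorem cons_mem_siegelDomain {a : ℂ} {v : Fin k → ℂ} :
    (Fin.cons a v : Fin (k + 1) → ℂ) ∈ siegelDomain (k + 1) ↔ ∑ i, ‖v i‖ ^ 2 < a.im := by
  rw [mem_siegelDomain_iff, siegelRho_cons, sub_pos]

theorem measurePreserving_cons :
    MeasurePreserving (fun p : ℂ × (Fin k → ℂ) => (Fin.cons p.1 p.2 : Fin (k + 1) → ℂ)) := by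
  have h := (volume_preserving_piFinSuccAbove (fun _ : Fin (k + 1) => ℂ) 0).symm
  convert h using 1
  ext p j
  simp [MeasurableEquiv.piFinSuccAbove, Fin.insertNthEquiv]

theorem measurableEmbedding_cons :
    MeasurableEmbedding (fun p : ℂ × (Fin k → ℂ) => (Fin.cons p.1 p.2 : Fin (k + 1) → ℂ)) := by
  have h := (MeasurableEquiv.piFinSuccAbove (fun _ : Fin (k + 1) => ℂ) 0).symm.measurableEmbedding
  convert h using 1
  ext p j
  simp [MeasurableEquiv.piFinSuccAbove, Fin.insertNthEquiv]

end Slices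

theorem lintegral_rpow_mul_one_add_rpow_lt_top {s q : ℝ} (hs : -1 < s) (hq : s + 1 < q) :
    ∫⁻ r in Set.Ioi (0 : ℝ), ENNReal.ofReal (r ^ s * (1 + r) ^ (-q)) < ∞ := by
  have h1 : IntegrableOn (fun r : ℝ => r ^ s) (Set.Ioc 0 1) :=
    (intervalIntegrable_iff_integrableOn_Ioc_of_le zero_le_one).1
      (intervalIntegral.intervalIntegrable_rpow' hs)
  have h2 : IntegrableOn (fun r : ℝ => r ^ (s - q)) (Set.Ioi 1) :=
    integrableOn_Ioi_rpow_of_lt (by linarith) one_pos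
  rw [← Set.Ioc_union_Ioi_eq_Ioi (zero_le_one : (0 : ℝ) ≤ 1)]
  refine (lintegral_union_le _ _ _).trans_lt (ENNReal.add_lt_top.2 ⟨?_, ?_⟩)
  · refine lt_of_le_of_lt (setLIntegral_mono' measurableSet_Ioc fun r hr => ?_) h1.lintegral_lt_top
    refine ENNReal.ofReal_le_ofReal (mul_le_of_le_one_right (Real.rpow_nonneg hr.1.le _) ?_)
    exact Real.rpow_le_one_of_one_le_of_nonpos (by linarith [hr.1]) (by linarith)
  · refine lt_of_le_of_lt (setLIntegral_mono' measurableSet_Ioi fun r hr => ?_) h2.lintegral_lt_top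
    have hr0 : (0 : ℝ) < r := zero_lt_one.trans hr
    rw [sub_eq_add_neg, Real.rpow_add hr0]
    have hle : (1 + r) ^ (-q) ≤ r ^ (-q) :=
      Real.rpow_le_rpow_of_nonpos hr0 (by linarith : r ≤ 1 + r) (by linarith : -q ≤ 0)
    gcongr

theorem lintegral_one_add_norm_rpow_lt_top {E : Type*} [NormedAddCommGroup E] [NormedSpace ℝ E]
    [FiniteDimensional ℝ E] [MeasurableSpace E] [BorelSpace E] (μ : Measure E)
    [μ.IsAddHaarMeasure] {r c : ℝ} (hr : (Module.finrank ℝ E : ℝ) < r) :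
    ∫⁻ x : E, ENNReal.ofReal (c * (1 + ‖x‖) ^ (-r)) ∂μ < ∞ :=
  ((integrable_one_add_norm hr).const_mul c).lintegral_lt_top

/-- Distributes the decay of a single modulus over three separate variables, so that the majorant
factors under Tonelli. -/
theorem rpow_neg_le_of_three_le {N A B C p q r : ℝ} (hA : 0 < A) (hB : 0 < B) (hC : 0 < C)
    (hAN : A ≤ N) (hBN : B ≤ N) (hCN : C ≤ N) (hp : 0 ≤ p) (hq : 0 ≤ q) (hr : 0 ≤ r) :
    N ^ (-(p + q + r)) ≤ A ^ (-p) * B ^ (-q) * C ^ (-r) := by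
  have hN : 0 < N := hA.trans_le hAN
  rw [show -(p + q + r) = -p + -q + -r by ring, Real.rpow_add hN, Real.rpow_add hN]
  gcongr ?_ * ?_ * ?_
  · exact Real.rpow_le_rpow_of_nonpos hA hAN (by linarith)
  · exact Real.rpow_le_rpow_of_nonpos hB hBN (by linarith)
  · exact Real.rpow_le_rpow_of_nonpos hC hCN (by linarith)

theorem lintegral_weight_mul_kernel_siegelBase_succ_lt_top {k : ℕ} {s β : ℝ} (hs : -1 < s)
    (hβ : s < β) :
    ∫⁻ u in siegelDomain (k + 1),
      ENNReal.ofReal (siegelWeight s u) * ‖siegelKernel β (siegelBase (k + 1)) u‖ₑ < ∞ := by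
  -- The slack `β - s` is shared equally: each of the variables `Im a`, `Re a` and `v` gets `d` more
  -- decay than its critical exponent `s + 1`, `1` and (for `1 + ‖v‖`) `2k`.
  obtain ⟨d, hd, hdβ⟩ : ∃ d : ℝ, 0 < d ∧ β = s + 3 * d := ⟨(β - s) / 3, by linarith, by ring⟩
  set G : (Fin (k + 1) → ℂ) → ℝ≥0∞ := fun u =>
    ENNReal.ofReal (siegelWeight s u) * ‖siegelKernel β (siegelBase (k + 1)) u‖ₑ with hG
  have hGm : Measurable G :=
    (measurable_siegelWeight s).ennreal_ofReal.mul (measurable_siegelKernel_right β _).enorm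
  have hIm : Measurable ((siegelDomain (k + 1)).indicator G) :=
    hGm.indicator measurableSet_siegelDomain
  set R : ℝ → ℝ≥0∞ := (Set.Ioi (0 : ℝ)).indicator
    fun r => ENNReal.ofReal (r ^ s * (1 + r) ^ (-(s + 1 + d))) with hR
  set X : ℝ → ℝ≥0∞ := fun x =>
    ENNReal.ofReal ((1 / 2 : ℝ) ^ (-(1 + d)) * (1 + ‖x‖) ^ (-(1 + d))) with hX
  set V : (Fin k → ℂ) → ℝ≥0∞ := fun v =>
    ENNReal.ofReal ((1 / 2 : ℝ) ^ (-(k + d)) * (1 + ‖v‖) ^ (-(2 * (k + d)))) with hV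
  have hRm : Measurable R :=
    Measurable.indicator (((measurable_id.pow_const _).mul
      ((measurable_const.add measurable_id).pow_const _)).ennreal_ofReal) measurableSet_Ioi
  have hXm : Measurable X := by
    refine Measurable.ennreal_ofReal (measurable_const.mul (Measurable.pow_const ?_ _))
    fun_prop
  -- Translating the first coordinate by `i|v|²` straightens the domain to a product: the defining
  -- function becomes `Im a` and the base of the kernel `1 + Im a + |v|² + i Re a`.
  have key : ∀ (v : Fin k → ℂ) (a : ℂ),
      (siegelDomain (k + 1)).indicator G
        (Fin.cons (a + Complex.I * ((∑ i, ‖v i‖ ^ 2 : ℝ) : ℂ)) v) ≤ V v * (X a.re * R a.im) := by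
    intro v a
    set Q := ∑ i, ‖v i‖ ^ 2 with hQ
    have him : (a + Complex.I * (Q : ℂ)).im - Q = a.im := by simp
    by_cases ha : 0 < a.im
    swap
    · rw [Set.indicator_of_notMem]
      · exact zero_le
      · rwa [cons_mem_siegelDomain, ← hQ, ← sub_pos, him]
    rw [Set.indicator_of_mem (by rwa [cons_mem_siegelDomain, ← hQ, ← sub_pos, him]), hR,
      Set.indicator_of_mem (by exact ha)]
    have hq : ‖v‖ ^ 2 ≤ Q := by
      have hq0 : 0 ≤ Q := Finset.sum_nonneg fun _ _ => sq_nonneg _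
      rw [← Real.sqrt_le_sqrt_iff hq0, Real.sqrt_sq (norm_nonneg _),
        pi_norm_le_iff_of_nonneg (Real.sqrt_nonneg _)]
      exact fun i => Real.le_sqrt_of_sq_le
        (Finset.single_le_sum (f := fun i => ‖v i‖ ^ 2) (fun _ _ => sq_nonneg _) (Finset.mem_univ i))
    simp only [hG, hV, hX]
    have hq0 : 0 ≤ Q := (sq_nonneg _).trans hq
    have hform : siegelForm (siegelBase (k + 1)) (Fin.cons (a + Complex.I * (Q : ℂ)) v) =
        ((1 + a.im + Q : ℝ) : ℂ) + Complex.I * a.re := by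
      rw [siegelForm_siegelBase]
      apply Complex.ext <;> simp
      ring
    rw [← ofReal_norm, norm_siegelKernel, hform, siegelWeight, siegelRho_cons, ← hQ, him,
      ← ENNReal.ofReal_mul (by positivity), ← ENNReal.ofReal_mul (by positivity),
      ← ENNReal.ofReal_mul (by positivity)]
    refine ENNReal.ofReal_le_ofReal ?_
    set N := ‖((1 + a.im + Q : ℝ) : ℂ) + Complex.I * a.re‖ with hN
    have hN1 : 1 + a.im + Q ≤ N := by
      refine le_trans (le_of_eq ?_) ((le_abs_self _).trans (Complex.abs_re_le_norm _))
      simp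
    have hN2 : ‖a.re‖ ≤ N := by
      refine le_trans (le_of_eq ?_) (Complex.abs_im_le_norm _)
      simp
    have hNle := rpow_neg_le_of_three_le (N := N) (A := 1 + a.im) (B := 1 / 2 * (1 + ‖a.re‖))
      (C := 1 / 2 * (1 + ‖v‖) ^ 2) (p := s + 1 + d) (q := 1 + d) (r := k + d)
      (by linarith) (by positivity) (by positivity) (by linarith) (by linarith)
      (by nlinarith [sq_nonneg (1 - ‖v‖)]) (by linarith) (by linarith) (by positivity)
    rw [show s + 1 + d + (1 + d) + (k + d) = β + ((k + 1 : ℕ) : ℝ) + 1 by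
      push_cast; linarith] at hNle
    rw [Real.mul_rpow (by norm_num) (by positivity), Real.mul_rpow (by norm_num) (by positivity),
      ← Real.rpow_natCast, ← Real.rpow_mul (by positivity),
      show ((2 : ℕ) : ℝ) * -(k + d) = -(2 * (k + d)) by push_cast; ring] at hNle
    calc a.im ^ s * N ^ (-(β + ((k + 1 : ℕ) : ℝ) + 1))
        ≤ a.im ^ s * _ := mul_le_mul_of_nonneg_left hNle (by positivity)
      _ = _ := by ring
  calc ∫⁻ u in siegelDomain (k + 1), G u
      = ∫⁻ u, (siegelDomain (k + 1)).indicator G u := by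
        rw [lintegral_indicator measurableSet_siegelDomain]
    _ = ∫⁻ p : ℂ × (Fin k → ℂ), (siegelDomain (k + 1)).indicator G (Fin.cons p.1 p.2) :=
        (measurePreserving_cons.lintegral_comp hIm).symm
    _ = ∫⁻ v : Fin k → ℂ, ∫⁻ a : ℂ, (siegelDomain (k + 1)).indicator G (Fin.cons a v) :=
        lintegral_prod_symm _ (hIm.comp measurePreserving_cons.measurable).aemeasurable
    _ = ∫⁻ v : Fin k → ℂ, ∫⁻ a : ℂ, (siegelDomain (k + 1)).indicator G
          (Fin.cons (a + Complex.I * ((∑ i, ‖v i‖ ^ 2 : ℝ) : ℂ)) v) := by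
        refine lintegral_congr fun v => ?_
        exact (lintegral_add_right_eq_self
          (fun a => (siegelDomain (k + 1)).indicator G (Fin.cons a v)) _).symm
    _ ≤ ∫⁻ v : Fin k → ℂ, ∫⁻ a : ℂ, V v * (X a.re * R a.im) :=
        lintegral_mono fun v => lintegral_mono fun a => key v a
    _ = (∫⁻ v, V v) * ((∫⁻ x, X x) * ∫⁻ r, R r) := by
        have h2 : ∫⁻ a : ℂ, X a.re * R a.im = (∫⁻ x, X x) * ∫⁻ r, R r := by
          rw [← lintegral_prod_mul hXm.aemeasurable hRm.aemeasurable]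
          exact (Complex.volume_preserving_equiv_real_prod.lintegral_comp
            (f := fun p : ℝ × ℝ => X p.1 * R p.2)
            ((hXm.comp measurable_fst).mul (hRm.comp measurable_snd)))
        have hm : Measurable fun a : ℂ => X a.re * R a.im :=
          (hXm.comp Complex.measurable_re).mul (hRm.comp Complex.measurable_im)
        simp_rw [lintegral_const_mul _ hm, h2]
        rw [lintegral_mul_const']
        rw [← h2]
        refine ne_of_lt ?_
        rw [h2]
        refine ENNReal.mul_lt_top (lintegral_one_add_norm_rpow_lt_top _ (by simp; linarith)) ?_
        rw [hR, lintegral_indicator measurableSet_Ioi]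
        exact lintegral_rpow_mul_one_add_rpow_lt_top hs (by linarith)
    _ < ∞ := by
        refine ENNReal.mul_lt_top (lintegral_one_add_norm_rpow_lt_top _ ?_)
          (ENNReal.mul_lt_top (lintegral_one_add_norm_rpow_lt_top _ (by simp; linarith)) ?_)
        · rw [Module.finrank_pi_fintype]
          simp
          linarith
        · rw [hR, lintegral_indicator measurableSet_Ioi]
          exact lintegral_rpow_mul_one_add_rpow_lt_top hs (by linarith)

/-- The Forelli–Rudin estimate: the weighted integral of the kernel is a multiple of a power
of the defining function. -/
theorem exists_lintegral_weight_mul_kernel_eq {n : ℕ} [NeZero n] {s β : ℝ} (hs : -1 < s)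
    (hβ : s < β) : ∃ I : ℝ≥0∞, I < ∞ ∧ ∀ z ∈ siegelDomain n,
      ∫⁻ w in siegelDomain n, ENNReal.ofReal (siegelWeight s w) * ‖siegelKernel β z w‖ₑ =
        I * ENNReal.ofReal (siegelWeight (s - β) z) := by
  refine ⟨_, ?_, fun z hz => (lintegral_weight_mul_kernel_eq hz s β).trans (mul_comm _ _)⟩
  obtain ⟨k, rfl⟩ := Nat.exists_eq_succ_of_ne_zero (NeZero.ne n)
  exact lintegral_weight_mul_kernel_siegelBase_succ_lt_top hs hβ

/-! ### Mean value property for circular domains. -/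

section MeanValue

/-- The mean value property on a circular domain, for a weight invariant under rotations. -/
theorem setIntegral_mul_eq_of_rotation_invariant {E : Type*} [NormedAddCommGroup E]
    [NormedSpace ℂ E] [MeasurableSpace E] [BorelSpace E] [SecondCountableTopology E]
    {μ : Measure E} [SFinite μ]
    (hμ : ∀ c : ℂ, ‖c‖ = 1 → MeasurePreserving (fun w : E => c • w) μ μ)
    {U : Set E} (hU : IsOpen U) (hUc : ∀ w ∈ U, ∀ c : ℂ, ‖c‖ ≤ 1 → c • w ∈ U)
    {F : E → ℂ} (hF : DifferentiableOn ℂ F U) {φ : E → ℝ}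
    (hφ : ∀ w, ∀ c : ℂ, ‖c‖ = 1 → φ (c • w) = φ w)
    (hint : IntegrableOn (fun w => F w * φ w) U μ) :
    ∫ w in U, F w * φ w ∂μ = F 0 * ((∫ w in U, φ w ∂μ : ℝ) : ℂ) := by
  set G : E → ℂ := U.indicator fun w => F w * φ w with hG
  have hGi : Integrable G μ := (integrable_indicator_iff hU.measurableSet).2 hint
  have hnorm : ∀ θ : ℝ, ‖circleMap 0 1 θ‖ = 1 := fun θ => by simp
  have hmem : ∀ w : E, ∀ c : ℂ, ‖c‖ = 1 → (c • w ∈ U ↔ w ∈ U) := by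
    intro w c hc
    refine ⟨fun h => ?_, fun h => hUc w h c hc.le⟩
    have h0 : c ≠ 0 := norm_ne_zero_iff.1 (by rw [hc]; exact one_ne_zero)
    have := hUc _ h c⁻¹ (by rw [norm_inv, hc, inv_one])
    rwa [smul_smul, inv_mul_cancel₀ h0, one_smul] at this
  -- This skew rotation carries integrability of `G` to the function of `(θ, w)`, which justifies
  -- Fubini. Integrating first in `w` removes `θ` by invariance; integrating first in `θ` gives `F
  -- 0` by the one-variable mean value property on the disc `c ↦ c • w`.
  have hskew : MeasurePreserving (fun p : ℝ × E => (p.1, circleMap 0 1 p.1 • p.2))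
      ((volume.restrict (Set.Ioc 0 (2 * Real.pi))).prod μ)
      ((volume.restrict (Set.Ioc 0 (2 * Real.pi))).prod μ) := by
    refine (MeasurePreserving.id _).skew_product (g := fun θ w => circleMap 0 1 θ • w) ?_ ?_
    · exact (((continuous_circleMap 0 1).comp continuous_fst).smul continuous_snd).measurable
    · exact Filter.Eventually.of_forall fun θ => (hμ _ (hnorm θ)).map_eq
  have hprod : Integrable (fun p : ℝ × E => G (circleMap 0 1 p.1 • p.2))
      ((volume.restrict (Set.Ioc 0 (2 * Real.pi))).prod μ) :=
    hskew.integrable_comp_of_integrable (g := fun p : ℝ × E => G p.2) (hGi.comp_snd _)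
  have hswap := integral_integral_swap (f := fun θ w => G (circleMap 0 1 θ • w)) hprod
  have hleft : ∀ θ : ℝ, ∫ w, G (circleMap 0 1 θ • w) ∂μ = ∫ w, G w ∂μ := by
    intro θ
    have h0 : circleMap 0 1 θ ≠ 0 := norm_ne_zero_iff.1 (by rw [hnorm]; exact one_ne_zero)
    exact (hμ _ (hnorm θ)).integral_comp (Homeomorph.smulOfNeZero _ h0).measurableEmbedding G
  have hright : ∀ w : E, ∫ θ in Set.Ioc 0 (2 * Real.pi), G (circleMap 0 1 θ • w) =
      2 * Real.pi * F 0 * ((U.indicator φ w : ℝ) : ℂ) := by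
    intro w
    by_cases hw : w ∈ U
    · have hd : DiffContOnCl ℂ (fun c : ℂ => F (c • w)) (Metric.ball 0 |1|) := by
        have hd' : DifferentiableOn ℂ (fun c : ℂ => F (c • w)) (Metric.closedBall 0 1) :=
          hF.comp ((differentiable_id.smul_const w).differentiableOn)
            fun c hc => hUc w hw c (by simpa using hc)
        refine DifferentiableOn.diffContOnCl ?_
        rw [abs_one, closure_ball _ one_ne_zero]
        exact hd'
      have hav := hd.circleAverage
      rw [Real.circleAverage_def, intervalIntegral.integral_of_le Real.two_pi_pos.le,
        inv_smul_eq_iff₀ Real.two_pi_pos.ne', zero_smul] at hav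
      have hval : ∀ θ : ℝ, G (circleMap 0 1 θ • w) = F (circleMap 0 1 θ • w) * φ w := fun θ => by
        rw [hG, Set.indicator_of_mem ((hmem w _ (hnorm θ)).2 hw), hφ w _ (hnorm θ)]
      simp_rw [hval]
      rw [integral_mul_const, hav, Set.indicator_of_mem hw]
      simp
    · have hval : ∀ θ : ℝ, G (circleMap 0 1 θ • w) = 0 := fun θ => by
        rw [hG, Set.indicator_of_notMem fun h => hw ((hmem w _ (hnorm θ)).1 h)]
      simp [hval, hw]
  simp_rw [hleft, hright] at hswap
  rw [integral_const, integral_const_mul, integral_complex_ofReal] at hswap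
  rw [integral_indicator hU.measurableSet, integral_indicator hU.measurableSet] at hswap
  have hvol : (volume.restrict (Set.Ioc 0 (2 * Real.pi))).real Set.univ = 2 * Real.pi := by
    simp [measureReal_def, Real.pi_pos.le]
  rw [hvol, Complex.real_smul, mul_assoc] at hswap
  have h2 : ((2 * Real.pi : ℝ) : ℂ) ≠ 0 := by exact_mod_cast Real.two_pi_pos.ne'
  refine mul_left_cancel₀ h2 ?_
  rw [hswap]
  push_cast
  ring

theorem measurePreserving_unit_mul {c : ℂ} (hc : ‖c‖ = 1) :
    MeasurePreserving (fun w : ℂ => c * w) :=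
  (rotation ⟨c, by simpa [Submonoid.unitSphere] using hc⟩).measurePreserving

theorem measurePreserving_unit_smul {k : ℕ} {c : ℂ} (hc : ‖c‖ = 1) :
    MeasurePreserving (fun w : Fin k → ℂ => c • w) :=
  volume_preserving_pi (fun _ => measurePreserving_unit_mul hc)

theorem setIntegral_pos_of_le_one {E : Type*} [MeasurableSpace E] {μ : Measure E} {U : Set E}
    (hU : MeasurableSet U) (hpos : 0 < μ U) (hfin : μ U < ∞) {φ : E → ℝ} (hφ : Measurable φ)
    (h0 : ∀ x ∈ U, 0 < φ x) (h1 : ∀ x ∈ U, φ x ≤ 1) : 0 < ∫ x in U, φ x ∂μ := by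
  have hi : IntegrableOn φ U μ := by
    refine Measure.integrableOn_of_bounded (M := 1) hfin.ne hφ.aestronglyMeasurable ?_
    filter_upwards [ae_restrict_mem hU] with x hx
    rw [Real.norm_of_nonneg (h0 x hx).le]
    exact h1 x hx
  rw [setIntegral_pos_iff_support_of_nonneg_ae ?_ hi]
  · have hs : U ⊆ Function.support φ := fun x hx => (h0 x hx).ne'
    rwa [Set.inter_eq_self_of_subset_right hs]
  · filter_upwards [ae_restrict_mem hU] with x hx using (h0 x hx).le

end MeanValue

/-! ### Cayley transform and the reproducing formula on the upper half plane. -/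

section HalfPlane

/-- The Cayley transform from the unit disc to the upper half plane. -/
noncomputable def cayley (ζ : ℂ) : ℂ := Complex.I * (1 + ζ) / (1 - ζ)

theorem one_sub_ne_zero_of_mem_ball {ζ : ℂ} (hζ : ζ ∈ Metric.ball (0 : ℂ) 1) : 1 - ζ ≠ 0 := by
  rintro h
  rw [← sub_eq_zero.1 h] at hζ
  simp at hζ

theorem one_sub_re_pos_of_mem_ball {ζ : ℂ} (hζ : ζ ∈ Metric.ball (0 : ℂ) 1) :
    0 < (1 - ζ).re := by
  have h1 := Complex.re_le_norm ζ
  have h2 : ‖ζ‖ < 1 := by simpa using hζ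
  rw [Complex.sub_re, Complex.one_re]
  linarith

theorem cayley_im {ζ : ℂ} (hζ : ζ ∈ Metric.ball (0 : ℂ) 1) :
    (cayley ζ).im = (1 - ‖ζ‖ ^ 2) / ‖1 - ζ‖ ^ 2 := by
  have h := one_sub_ne_zero_of_mem_ball hζ
  have h' : Complex.normSq (1 - ζ) ≠ 0 := by simpa using h
  rw [cayley, Complex.div_im, ← Complex.normSq_eq_norm_sq, ← Complex.normSq_eq_norm_sq]
  field_simp
  simp [Complex.normSq_apply]
  ring

theorem one_add_I_mul_conj_cayley {ζ : ℂ} (hζ : ζ ∈ Metric.ball (0 : ℂ) 1) :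
    1 + Complex.I * conj (cayley ζ) = (2 : ℝ) * (conj (1 - ζ))⁻¹ := by
  have h : conj (1 - ζ) ≠ 0 := (map_ne_zero _).2 (one_sub_ne_zero_of_mem_ball hζ)
  rw [cayley, map_div₀, map_mul, Complex.conj_I]
  field_simp
  simp
  ring_nf

theorem hasDerivAt_cayley {ζ : ℂ} (hζ : ζ ∈ Metric.ball (0 : ℂ) 1) :
    HasDerivAt cayley (2 * Complex.I / (1 - ζ) ^ 2) ζ := by
  have h := one_sub_ne_zero_of_mem_ball hζ
  have h1 : HasDerivAt (fun ζ : ℂ => Complex.I * (1 + ζ)) (Complex.I * 1) ζ :=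
    ((hasDerivAt_id ζ).const_add 1).const_mul _
  have h2 : HasDerivAt (fun ζ : ℂ => 1 - ζ) (-1) ζ := (hasDerivAt_id ζ).const_sub 1
  refine (h1.div h2 h).congr_deriv ?_
  congr 1
  ring

theorem cayley_injOn : Set.InjOn cayley (Metric.ball 0 1) := by
  intro ζ hζ ξ hξ h
  have h1 := one_sub_ne_zero_of_mem_ball hζ
  have h2 := one_sub_ne_zero_of_mem_ball hξ
  rw [cayley, cayley, div_eq_div_iff h1 h2] at h
  have h3 : Complex.I * 2 * (ζ - ξ) = 0 := by linear_combination h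
  simpa [sub_eq_zero] using h3

theorem cayley_image : cayley '' Metric.ball 0 1 = {a : ℂ | 0 < a.im} := by
  ext a
  constructor
  · rintro ⟨ζ, hζ, rfl⟩
    rw [Set.mem_ofPred_eq, cayley_im hζ]
    have h1 : ‖ζ‖ < 1 := by simpa using hζ
    have h2 := norm_pos_iff.2 (one_sub_ne_zero_of_mem_ball hζ)
    have : 0 < 1 - ‖ζ‖ ^ 2 := by nlinarith [norm_nonneg ζ]
    positivity
  · intro ha
    rw [Set.mem_ofPred_eq] at ha
    have hne : a + Complex.I ≠ 0 := fun h => by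
      have := congrArg Complex.im h
      simp at this
      linarith
    refine ⟨(a - Complex.I) / (a + Complex.I), ?_, ?_⟩
    · rw [mem_ball_zero_iff, norm_div, div_lt_one (norm_pos_iff.2 hne),
        ← sq_lt_sq₀ (norm_nonneg _) (norm_nonneg _), ← Complex.normSq_eq_norm_sq,
        ← Complex.normSq_eq_norm_sq, Complex.normSq_apply, Complex.normSq_apply]
      simp
      nlinarith
    · have h2 : 1 - (a - Complex.I) / (a + Complex.I) = 2 * Complex.I / (a + Complex.I) := by
        field_simp
        ring
      rw [cayley, h2]
      field_simp
      ring

/-- The real derivative of the Cayley transform. -/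
noncomputable def cayleyFDeriv (ζ : ℂ) : ℂ →L[ℝ] ℂ :=
  (ContinuousLinearMap.toSpanSingleton ℂ (2 * Complex.I / (1 - ζ) ^ 2)).restrictScalars ℝ

theorem abs_det_cayleyFDeriv (ζ : ℂ) : |(cayleyFDeriv ζ).det| = 4 / ‖1 - ζ‖ ^ 4 := by
  have h : (cayleyFDeriv ζ).det = ((LinearMap.toSpanSingleton ℂ ℂ
      (2 * Complex.I / (1 - ζ) ^ 2)).restrictScalars ℝ).det := rfl
  rw [h, LinearMap.det_restrictScalars, Algebra.norm_complex_eq]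
  change |Complex.normSq _| = _
  rw [abs_of_nonneg (Complex.normSq_nonneg _), LinearMap.det_ring, Complex.normSq_eq_norm_sq]
  simp
  ring

theorem hasFDerivAt_cayley {ζ : ℂ} (hζ : ζ ∈ Metric.ball (0 : ℂ) 1) :
    HasFDerivAt cayley (cayleyFDeriv ζ) ζ :=
  (hasDerivAt_cayley hζ).hasFDerivAt.restrictScalars ℝ

/-- The Jacobian and the weight together turn the antiholomorphic kernel factor into the holomorphic
`(1 - ζ)^(-(b+2))`, leaving only a radial weight. This is what makes the mean value property
applicable. -/
theorem cayley_integrand {ζ : ℂ} (hζ : ζ ∈ Metric.ball (0 : ℂ) 1) (b : ℝ) (x : ℂ) :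
    (4 / ‖1 - ζ‖ ^ 4 : ℝ) • (x * ((cayley ζ).im ^ b : ℝ) *
      (1 + Complex.I * conj (cayley ζ)) ^ ((-(b + 2) : ℝ) : ℂ)) =
    ((2 : ℝ) ^ (-b) : ℝ) * (x * (1 - ζ) ^ ((-(b + 2) : ℝ) : ℂ) *
      ((1 - ‖ζ‖ ^ 2) ^ b : ℝ)) := by
  have hre := one_sub_re_pos_of_mem_ball hζ
  have hne := one_sub_ne_zero_of_mem_ball hζ
  have h1 : ‖ζ‖ < 1 := by simpa using hζ
  have hN : 0 < ‖1 - ζ‖ := norm_pos_iff.2 hne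
  have hpos : 0 < 1 - ‖ζ‖ ^ 2 := by nlinarith [norm_nonneg ζ]
  have hcne : conj (1 - ζ) ≠ 0 := (map_ne_zero _).2 hne
  have harg : (conj (1 - ζ)).arg ≠ Real.pi := by
    rw [ne_eq, Complex.arg_eq_pi_iff, not_and_or, not_lt]
    left
    rw [Complex.conj_re]
    exact hre.le
  have harg' : (1 - ζ).arg ≠ Real.pi := by
    rw [ne_eq, Complex.arg_eq_pi_iff, not_and_or, not_lt]
    exact Or.inl hre.le
  set W : ℂ := (1 - ζ) ^ (((b + 2) : ℝ) : ℂ) with hW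
  have hW0 : W ≠ 0 := by
    rw [hW, Complex.cpow_def_of_ne_zero hne]
    exact Complex.exp_ne_zero _
  have hWn : W * conj W = ((‖1 - ζ‖ ^ (2 * (b + 2)) : ℝ) : ℂ) := by
    rw [Complex.mul_conj, Complex.normSq_eq_norm_sq, hW, Complex.norm_cpow_real,
      ← Real.rpow_natCast, ← Real.rpow_mul hN.le]
    congr 2
    push_cast
    ring
  have e1 : (1 - ζ) ^ ((-(b + 2) : ℝ) : ℂ) = W⁻¹ := by
    rw [hW, Complex.ofReal_neg, Complex.cpow_neg]
  have e2 : (1 + Complex.I * conj (cayley ζ)) ^ ((-(b + 2) : ℝ) : ℂ) =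
      ((2 : ℝ) ^ (-(b + 2)) : ℝ) * conj W := by
    rw [one_add_I_mul_conj_cayley hζ, Complex.cpow_def_of_ne_zero
      (mul_ne_zero (by norm_num) (inv_ne_zero hcne)), Complex.log_ofReal_mul two_pos
      (inv_ne_zero hcne), add_mul, Complex.exp_add, Complex.log_inv _ harg]
    congr 1
    · rw [Real.rpow_def_of_pos two_pos]
      push_cast
      rfl
    · rw [hW, ← Complex.conj_ofReal (b + 2), Complex.cpow_conj _ _ harg', Complex.conj_conj,
        Complex.cpow_def_of_ne_zero hcne]
      congr 1
      push_cast
      ring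
  -- The antiholomorphic power is a power of the modulus times a holomorphic one; the modulus is
  -- then absorbed by the Jacobian and the weight in `e4`.
  have e3 : conj W = ((‖1 - ζ‖ ^ (2 * (b + 2)) : ℝ) : ℂ) * W⁻¹ := by
    rw [← hWn]
    field_simp
  have e4 : (4 / ‖1 - ζ‖ ^ 4) * (cayley ζ).im ^ b * 2 ^ (-(b + 2)) * ‖1 - ζ‖ ^ (2 * (b + 2)) =
      2 ^ (-b) * (1 - ‖ζ‖ ^ 2) ^ b := by
    rw [cayley_im hζ, Real.div_rpow hpos.le (by positivity), ← Real.rpow_natCast ‖1 - ζ‖ 2,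
      ← Real.rpow_mul hN.le, ← Real.rpow_natCast ‖1 - ζ‖ 4,
      show 2 * (b + 2) = ((2 : ℕ) : ℝ) * b + ((4 : ℕ) : ℝ) by push_cast; ring,
      Real.rpow_add hN, show -(b + 2) = -b + -2 by ring, Real.rpow_add two_pos,
      show (2 : ℝ) ^ (-2 : ℝ) = 1 / 4 by
        rw [Real.rpow_neg two_pos.le]; norm_num]
    have := Real.rpow_pos_of_pos hN (((2 : ℕ) : ℝ) * b)
    have := Real.rpow_pos_of_pos hN ((4 : ℕ) : ℝ)
    field_simp
  rw [e1, e2, e3, Complex.real_smul]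
  have e5 := congrArg (fun r : ℝ => (r : ℂ)) e4
  simp only [Complex.ofReal_mul] at e5
  linear_combination (x * W⁻¹) * e5

/-- The reproducing formula for the upper half plane, at the point `i`. -/
theorem integral_halfPlane_eq {h : ℂ → ℂ} (hh : DifferentiableOn ℂ h {a : ℂ | 0 < a.im}) {b : ℝ}
    (hint : IntegrableOn (fun a : ℂ => h a * (a.im ^ b : ℝ) *
      (1 + Complex.I * conj a) ^ ((-(b + 2) : ℝ) : ℂ)) {a : ℂ | 0 < a.im}) :
    ∫ a in {a : ℂ | 0 < a.im}, h a * (a.im ^ b : ℝ) *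
      (1 + Complex.I * conj a) ^ ((-(b + 2) : ℝ) : ℂ) =
    h Complex.I * ((2 ^ (-b) * ∫ ζ in Metric.ball (0 : ℂ) 1, (1 - ‖ζ‖ ^ 2) ^ b : ℝ) : ℂ) := by
  rw [← cayley_image, integrableOn_image_iff_integrableOn_abs_det_fderiv_smul volume
    measurableSet_ball (fun ζ hζ => (hasFDerivAt_cayley hζ).hasFDerivWithinAt) cayley_injOn] at hint
  simp_rw [abs_det_cayleyFDeriv] at hint
  rw [integrableOn_congr_fun (fun ζ hζ => cayley_integrand hζ b _) measurableSet_ball] at hint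
  rw [← cayley_image, integral_image_eq_integral_abs_det_fderiv_smul volume
    measurableSet_ball (fun ζ hζ => (hasFDerivAt_cayley hζ).hasFDerivWithinAt) cayley_injOn]
  simp_rw [abs_det_cayleyFDeriv]
  rw [setIntegral_congr_fun measurableSet_ball (fun ζ hζ => cayley_integrand hζ b _),
    integral_const_mul]
  have h2 : (((2 : ℝ) ^ (-b) : ℝ) : ℂ) ≠ 0 := by
    exact_mod_cast (Real.rpow_pos_of_pos two_pos _).ne'
  have hint' : IntegrableOn (fun ζ : ℂ => h (cayley ζ) * (1 - ζ) ^ ((-(b + 2) : ℝ) : ℂ) *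
      ((1 - ‖ζ‖ ^ 2) ^ b : ℝ)) (Metric.ball 0 1) :=
    (integrable_const_mul_iff (isUnit_iff_ne_zero.2 h2) _).1 hint
  have hd : DifferentiableOn ℂ (fun ζ : ℂ => h (cayley ζ) * (1 - ζ) ^ ((-(b + 2) : ℝ) : ℂ))
      (Metric.ball 0 1) := by
    refine DifferentiableOn.mul ?_ ?_
    · refine hh.comp (fun ζ hζ => (hasDerivAt_cayley hζ).differentiableAt.differentiableWithinAt) ?_
      rw [← cayley_image]
      exact Set.mapsTo_image _ _
    · refine DifferentiableOn.cpow_const ((differentiable_const _).sub differentiable_id).differentiableOn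
        fun ζ hζ => Or.inl (one_sub_re_pos_of_mem_ball hζ)
  rw [setIntegral_mul_eq_of_rotation_invariant (fun c hc => measurePreserving_unit_mul hc)
    Metric.isOpen_ball ?_ hd ?_ hint']
  · simp only [cayley, sub_zero, add_zero, mul_one, div_one, Complex.one_cpow]
    push_cast
    ring
  · intro w hw c hc
    rw [mem_ball_zero_iff] at hw ⊢
    rw [norm_smul]
    exact (mul_le_of_le_one_left (norm_nonneg _) hc).trans_lt hw
  · intro w c hc
    rw [norm_smul, hc, one_mul]

theorem integral_ball_one_sub_norm_sq_rpow_pos {b : ℝ} (hb : 0 ≤ b) :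
    0 < ∫ ζ in Metric.ball (0 : ℂ) 1, (1 - ‖ζ‖ ^ 2) ^ b := by
  have h : ∀ ζ ∈ Metric.ball (0 : ℂ) 1, 0 < 1 - ‖ζ‖ ^ 2 := fun ζ hζ => by
    have h1 : ‖ζ‖ < 1 := by simpa using hζ
    nlinarith [norm_nonneg ζ]
  refine setIntegral_pos_of_le_one measurableSet_ball (Metric.measure_ball_pos _ _ one_pos)
    measure_ball_lt_top (Measurable.pow_const (by fun_prop) _)
    (fun ζ hζ => Real.rpow_pos_of_pos (h ζ hζ) _) fun ζ hζ => ?_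
  exact Real.rpow_le_one (h ζ hζ).le (by linarith [sq_nonneg ‖ζ‖]) hb

end HalfPlane

/-! ### Reproducing formula on the Siegel domain. -/

section Reproducing

/-- The open Euclidean ball `{v : ∑ |v i|² < y}` of squared radius `y`. -/
def sqBall (k : ℕ) (y : ℝ) : Set (Fin k → ℂ) := {v | ∑ i, ‖v i‖ ^ 2 < y}

theorem isOpen_sqBall (k : ℕ) (y : ℝ) : IsOpen (sqBall k y) :=
  isOpen_lt (by fun_prop) continuous_const

theorem sum_norm_sq_smul {k : ℕ} (c : ℂ) (v : Fin k → ℂ) :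
    ∑ i, ‖(c • v) i‖ ^ 2 = ‖c‖ ^ 2 * ∑ i, ‖v i‖ ^ 2 := by
  simp only [Pi.smul_apply, norm_smul, mul_pow, Finset.mul_sum]

theorem sum_norm_sq_nonneg {k : ℕ} (v : Fin k → ℂ) : 0 ≤ ∑ i, ‖v i‖ ^ 2 :=
  Finset.sum_nonneg fun _ _ => sq_nonneg _

theorem smul_mem_sqBall {k : ℕ} {y : ℝ} {v : Fin k → ℂ} (hv : v ∈ sqBall k y) {c : ℂ}
    (hc : ‖c‖ ≤ 1) : c • v ∈ sqBall k y := by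
  simp only [sqBall, Set.mem_ofPred_eq, sum_norm_sq_smul] at hv ⊢
  refine lt_of_le_of_lt (mul_le_of_le_one_left (sum_norm_sq_nonneg v) ?_) hv
  exact pow_le_one₀ (norm_nonneg _) hc

/-- Dilation by `√y`; the real dimension `2k` contributes the extra factor `y^k`. -/
theorem integral_sqBall_scale (k : ℕ) (β : ℝ) {y : ℝ} (hy : 0 < y) :
    ∫ v in sqBall k y, (y - ∑ i, ‖v i‖ ^ 2) ^ β =
      y ^ (β + k) * ∫ v in sqBall k 1, (1 - ∑ i, ‖v i‖ ^ 2) ^ β := by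
  rw [← integral_indicator (isOpen_sqBall k y).measurableSet,
    ← integral_indicator (isOpen_sqBall k 1).measurableSet]
  have h := Measure.integral_comp_smul (volume : Measure (Fin k → ℂ))
    ((sqBall k y).indicator fun v => (y - ∑ i, ‖v i‖ ^ 2) ^ β) (√y)
  have hs : 0 < √y := Real.sqrt_pos.2 hy
  have hq : ∀ v : Fin k → ℂ, ∑ i, ‖(√y • v) i‖ ^ 2 = y * ∑ i, ‖v i‖ ^ 2 := fun v => by
    simp only [Pi.smul_apply, norm_smul, mul_pow, Finset.mul_sum, Real.norm_of_nonneg hs.le,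
      Real.sq_sqrt hy.le]
  have hcomp : ∀ v : Fin k → ℂ,
      ((sqBall k y).indicator fun v => (y - ∑ i, ‖v i‖ ^ 2) ^ β) (√y • v) =
      y ^ β * ((sqBall k 1).indicator fun v => (1 - ∑ i, ‖v i‖ ^ 2) ^ β) v := by
    intro v
    have hmem : √y • v ∈ sqBall k y ↔ v ∈ sqBall k 1 := by
      simp only [sqBall, Set.mem_ofPred_eq, hq]
      exact mul_lt_iff_lt_one_right hy
    by_cases hv : v ∈ sqBall k 1
    · rw [Set.indicator_of_mem (hmem.2 hv), Set.indicator_of_mem hv, hq,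
        ← Real.mul_rpow hy.le (sub_nonneg.2 (le_of_lt hv))]
      ring_nf
    · rw [Set.indicator_of_notMem (fun h => hv (hmem.1 h)), Set.indicator_of_notMem hv, mul_zero]
  simp_rw [hcomp] at h
  have hfr : Module.finrank ℝ (Fin k → ℂ) = 2 * k := by
    rw [Module.finrank_pi_fintype]
    simp
    ring
  rw [integral_const_mul, hfr, pow_mul, Real.sq_sqrt hy.le, abs_of_pos (inv_pos.2 (pow_pos hy k)),
    smul_eq_mul] at h
  rw [Real.rpow_add hy, Real.rpow_natCast, mul_right_comm, h]
  have := pow_pos hy k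
  field_simp

theorem integral_sqBall_one_pos (k : ℕ) {β : ℝ} (hβ : 0 ≤ β) :
    0 < ∫ v in sqBall k 1, (1 - ∑ i, ‖v i‖ ^ 2) ^ β := by
  have hpos : ∀ v ∈ sqBall k 1, 0 < 1 - ∑ i, ‖v i‖ ^ 2 := fun v hv => sub_pos.2 hv
  refine setIntegral_pos_of_le_one (isOpen_sqBall k 1).measurableSet ?_ ?_
    (Measurable.pow_const (by fun_prop) _) (fun v hv => Real.rpow_pos_of_pos (hpos v hv) _)
    fun v hv => Real.rpow_le_one (hpos v hv).le (by linarith [sum_norm_sq_nonneg v]) hβ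
  · exact (isOpen_sqBall k 1).measure_pos _ ⟨0, by simp [sqBall]⟩
  · refine lt_of_le_of_lt (measure_mono (fun v hv => ?_))
      (measure_closedBall_lt_top (x := (0 : Fin k → ℂ)) (r := 1))
    rw [mem_closedBall_zero_iff, pi_norm_le_iff_of_nonneg zero_le_one]
    intro i
    have h1 : ‖v i‖ ^ 2 ≤ ∑ i, ‖v i‖ ^ 2 :=
      Finset.single_le_sum (f := fun i => ‖v i‖ ^ 2) (fun _ _ => sq_nonneg _) (Finset.mem_univ i)
    have h2 : ∑ i, ‖v i‖ ^ 2 < 1 := hv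
    nlinarith [norm_nonneg (v i)]

theorem siegelBase_eq_cons (k : ℕ) :
    siegelBase (k + 1) = (Fin.cons Complex.I 0 : Fin (k + 1) → ℂ) := by
  ext j
  refine Fin.cases ?_ (fun i => ?_) j <;> simp [siegelBase]

theorem differentiable_cons_left {k : ℕ} (v : Fin k → ℂ) :
    Differentiable ℂ fun a : ℂ => (Fin.cons a v : Fin (k + 1) → ℂ) := by
  rw [differentiable_pi]
  refine Fin.cases ?_ fun i => ?_
  · simp
  · simp

theorem differentiable_cons_right {k : ℕ} (a : ℂ) :
    Differentiable ℂ fun v : Fin k → ℂ => (Fin.cons a v : Fin (k + 1) → ℂ) := by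
  rw [differentiable_pi]
  refine Fin.cases ?_ fun i => ?_
  · simp
  · simpa using differentiable_apply i

/-- The normalising constant of the reproducing formula on the Siegel domain. -/
noncomputable def reproducingConst (k : ℕ) (β : ℝ) : ℝ :=
  (∫ v in sqBall k 1, (1 - ∑ i, ‖v i‖ ^ 2) ^ β) *
    (2 ^ (-(β + k)) * ∫ ζ in Metric.ball (0 : ℂ) 1, (1 - ‖ζ‖ ^ 2) ^ (β + k))

theorem reproducingConst_pos (k : ℕ) {β : ℝ} (hβ : 0 ≤ β) : 0 < reproducingConst k β :=
  mul_pos (integral_sqBall_one_pos k hβ) (mul_pos (Real.rpow_pos_of_pos two_pos _)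
    (integral_ball_one_sub_norm_sq_rpow_pos (by positivity)))

/-- For fixed `a` the base-point kernel is constant in `v` and the weight is rotation invariant, so
the mean value property replaces `f (a, v)` by `f (a, 0)`. The ball volume raises the weight
exponent to `b = β + k`, exactly the one matching the half-plane kernel exponent `-(b + 2)`. -/
theorem integral_slice_siegelDomain {k : ℕ} {β : ℝ} {f : (Fin (k + 1) → ℂ) → ℂ}
    (hf : DifferentiableOn ℂ f (siegelDomain (k + 1))) (a : ℂ)
    (hint : Integrable fun v : Fin k → ℂ =>
      (siegelDomain (k + 1)).indicator (fun w => f w * (siegelWeight β w : ℂ) *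
        siegelKernel β (siegelBase (k + 1)) w) (Fin.cons a v)) :
    ∫ v : Fin k → ℂ, (siegelDomain (k + 1)).indicator (fun w => f w * (siegelWeight β w : ℂ) *
        siegelKernel β (siegelBase (k + 1)) w) (Fin.cons a v) =
      ((∫ v in sqBall k 1, (1 - ∑ i, ‖v i‖ ^ 2) ^ β : ℝ) : ℂ) *
      {a : ℂ | 0 < a.im}.indicator (fun a => f (Fin.cons a 0) * (a.im ^ (β + k) : ℝ) *
        (1 + Complex.I * conj a) ^ ((-(β + k + 2) : ℝ) : ℂ)) a := by
  have hker : ∀ v : Fin k → ℂ, siegelKernel β (siegelBase (k + 1)) (Fin.cons a v) =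
      (1 + Complex.I * conj a) ^ ((-(β + k + 2) : ℝ) : ℂ) := by
    intro v
    rw [siegelKernel, siegelForm_siegelBase, Fin.cons_zero]
    congr 3
    push_cast
    ring
  have hind : (fun v : Fin k → ℂ =>
      (siegelDomain (k + 1)).indicator (fun w => f w * (siegelWeight β w : ℂ) *
        siegelKernel β (siegelBase (k + 1)) w) (Fin.cons a v)) =
      (sqBall k a.im).indicator (fun v => (f (Fin.cons a v) *
        (1 + Complex.I * conj a) ^ ((-(β + k + 2) : ℝ) : ℂ)) *
          (((a.im - ∑ i, ‖v i‖ ^ 2) ^ β : ℝ) : ℂ)) := by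
    ext v
    by_cases hv : v ∈ sqBall k a.im
    · rw [Set.indicator_of_mem hv, Set.indicator_of_mem (cons_mem_siegelDomain.2 hv), hker,
        siegelWeight, siegelRho_cons]
      ring
    · rw [Set.indicator_of_notMem hv,
        Set.indicator_of_notMem fun h => hv (cons_mem_siegelDomain.1 h)]
  rw [hind, integrable_indicator_iff (isOpen_sqBall _ _).measurableSet] at hint
  rw [hind, integral_indicator (isOpen_sqBall _ _).measurableSet]
  by_cases ha : 0 < a.im
  · have hd : DifferentiableOn ℂ (fun v : Fin k → ℂ => f (Fin.cons a v) *
        (1 + Complex.I * conj a) ^ ((-(β + k + 2) : ℝ) : ℂ)) (sqBall k a.im) :=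
      (hf.comp (differentiable_cons_right a).differentiableOn
        fun v hv => cons_mem_siegelDomain.2 hv).mul_const _
    rw [setIntegral_mul_eq_of_rotation_invariant (fun c hc => measurePreserving_unit_smul hc)
      (isOpen_sqBall _ _) (fun w hw c hc => smul_mem_sqBall hw hc) hd
      (fun w c hc => by rw [sum_norm_sq_smul, hc, one_pow, one_mul]) hint,
      integral_sqBall_scale k β ha, Set.indicator_of_mem (by exact ha)]
    push_cast
    ring
  · have hempty : sqBall k a.im = ∅ := by
      ext v
      simp only [sqBall, Set.mem_ofPred_eq, Set.mem_empty_iff_false, iff_false, not_lt]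
      exact (not_lt.1 ha).trans (sum_norm_sq_nonneg v)
    rw [hempty, Measure.restrict_empty, integral_zero_measure, Set.indicator_of_notMem
      (by exact ha), mul_zero]

theorem integral_mul_kernel_siegelBase {k : ℕ} {β : ℝ} (hβ : 0 ≤ β)
    {f : (Fin (k + 1) → ℂ) → ℂ} (hf : DifferentiableOn ℂ f (siegelDomain (k + 1)))
    (hint : IntegrableOn (fun w => f w * (siegelWeight β w : ℂ) *
      siegelKernel β (siegelBase (k + 1)) w) (siegelDomain (k + 1))) :
    ∫ w in siegelDomain (k + 1), f w * (siegelWeight β w : ℂ) *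
      siegelKernel β (siegelBase (k + 1)) w =
      reproducingConst k β * f (siegelBase (k + 1)) := by
  rw [← integrable_indicator_iff measurableSet_siegelDomain,
    ← measurePreserving_cons.integrable_comp_emb measurableEmbedding_cons] at hint
  have hslice := hint.prod_right_ae
  have hleft := hint.integral_prod_left
  have hC : ((∫ v in sqBall k 1, (1 - ∑ i, ‖v i‖ ^ 2) ^ β : ℝ) : ℂ) ≠ 0 := by
    exact_mod_cast (integral_sqBall_one_pos k hβ).ne'
  have hae := hslice.mono fun a ha => integral_slice_siegelDomain hf a ha
  have hhalf : MeasurableSet {a : ℂ | 0 < a.im} := measurableSet_lt measurable_const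
    Complex.measurable_im
  rw [← integral_indicator measurableSet_siegelDomain,
    ← measurePreserving_cons.integral_comp measurableEmbedding_cons]
  have hfub := integral_prod _ hint
  simp only [Function.comp_apply] at hfub hleft
  rw [Measure.volume_eq_prod, hfub, integral_congr_ae hae, integral_const_mul,
    integral_indicator hhalf]
  -- Fubini gives integrability of the slice integrals; dividing by the nonzero ball constant turns
  -- this into the hypothesis of the half-plane formula.
  rw [integrable_congr hae, integrable_const_mul_iff (isUnit_iff_ne_zero.2 hC),
    integrable_indicator_iff hhalf] at hleft
  rw [integral_halfPlane_eq (h := fun a => f (Fin.cons a 0)) ?_ hleft, ← siegelBase_eq_cons,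
    reproducingConst]
  · push_cast
    ring
  · refine hf.comp (differentiable_cons_left 0).differentiableOn fun a ha => ?_
    rw [cons_mem_siegelDomain]
    simpa using ha

/-- The reproducing formula on the Siegel domain. -/
theorem integral_mul_kernel {n : ℕ} [NeZero n] {β : ℝ} (hβ : 0 ≤ β) {f : (Fin n → ℂ) → ℂ}
    (hf : DifferentiableOn ℂ f (siegelDomain n)) {z : Fin n → ℂ} (hz : z ∈ siegelDomain n)
    (hint : IntegrableOn (fun w => f w * (siegelWeight β w : ℂ) * siegelKernel β z w)
      (siegelDomain n)) :
    ∫ w in siegelDomain n, f w * (siegelWeight β w : ℂ) * siegelKernel β z w =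
      reproducingConst (n - 1) β * f z := by
  have hcongr : Set.EqOn (fun u => |(siegelLinear z).det| • (f (siegelMap z u) *
        (siegelWeight β (siegelMap z u) : ℂ) * siegelKernel β z (siegelMap z u)))
      (fun u => (f ∘ siegelMap z) u * (siegelWeight β u : ℂ) * siegelKernel β (siegelBase n) u)
      (siegelDomain n) := by
    intro u hu
    have h := siegelKernel_siegelMap hz β (siegelBase n) u
    rw [siegelMap_siegelBase] at h
    have h0 := mem_siegelDomain_iff.1 hz
    -- The powers of `ρ(z)` cancel completely, so the constant at `z` is the one at the base point.
    have hw : siegelRho z ^ (n + 1) * siegelWeight β z * siegelWeight (-(β + n + 1)) z = 1 := by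
      simp only [siegelWeight]
      rw [← Real.rpow_natCast, ← Real.rpow_add h0, ← Real.rpow_add h0,
        show ((n + 1 : ℕ) : ℝ) + β + -(β + n + 1) = 0 by push_cast; ring, Real.rpow_zero]
    have hwc := congrArg (fun r : ℝ => (r : ℂ)) hw
    simp only [Complex.ofReal_mul, Complex.ofReal_one] at hwc
    simp only [abs_det_siegelLinear hz, h, siegelWeight_siegelMap hz hu, Complex.real_smul,
      Complex.ofReal_mul, Function.comp_apply]
    linear_combination (f (siegelMap z u) * (siegelWeight β u : ℂ) *
      siegelKernel β (siegelBase n) u) * hwc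
  rw [← siegelMap_image hz, integrableOn_image_iff_integrableOn_abs_det_fderiv_smul volume
    measurableSet_siegelDomain (fun u _ => (hasFDerivAt_siegelMap z u).hasFDerivWithinAt)
    (siegelMap_bijective hz).1.injOn, integrableOn_congr_fun hcongr measurableSet_siegelDomain]
    at hint
  rw [← siegelMap_image hz, integral_image_eq_integral_abs_det_fderiv_smul volume
    measurableSet_siegelDomain (fun u _ => (hasFDerivAt_siegelMap z u).hasFDerivWithinAt)
    (siegelMap_bijective hz).1.injOn, setIntegral_congr_fun measurableSet_siegelDomain hcongr]
  have hd : DifferentiableOn ℂ (f ∘ siegelMap z) (siegelDomain n) :=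
    hf.comp (differentiable_siegelMap z).differentiableOn fun u hu => (siegelMap_mem_iff hz).2 hu
  obtain ⟨k, rfl⟩ := Nat.exists_eq_succ_of_ne_zero (NeZero.ne n)
  refine (integral_mul_kernel_siegelBase hβ hd hint).trans ?_
  have hb := siegelMap_siegelBase z
  exact congrArg (fun x => (reproducingConst k β : ℂ) * f x) hb

end Reproducing

/-! ### Holomorphy of kernel integrals over subsets of the domain. -/

section Holomorphy

variable {n : ℕ} [NeZero n]

/-- The derivative of `z ↦ siegelForm z w`. -/
noncomputable def siegelFormDeriv (w : Fin n → ℂ) : (Fin n → ℂ) →L[ℂ] ℂ :=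
  (-Complex.I) • ContinuousLinearMap.proj 0 -
    (2 : ℂ) • ∑ j ∈ Finset.univ.erase (0 : Fin n), conj (w j) • ContinuousLinearMap.proj j

theorem siegelFormDeriv_apply (w x : Fin n → ℂ) : siegelFormDeriv w x =
    -Complex.I * x 0 - 2 * ∑ j ∈ Finset.univ.erase (0 : Fin n), x j * conj (w j) := by
  simp [siegelFormDeriv, mul_comm]

theorem siegelForm_eq_siegelFormDeriv (z w : Fin n → ℂ) :
    siegelForm z w = siegelFormDeriv w z + Complex.I * conj (w 0) := by
  rw [siegelFormDeriv_apply, siegelForm]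
  ring

theorem hasFDerivAt_siegelForm (z w : Fin n → ℂ) :
    HasFDerivAt (fun z => siegelForm z w) (siegelFormDeriv w) z := by
  simp_rw [siegelForm_eq_siegelFormDeriv]
  exact (siegelFormDeriv w).hasFDerivAt.add_const _

theorem continuous_siegelFormDeriv :
    Continuous (siegelFormDeriv : (Fin n → ℂ) → (Fin n → ℂ) →L[ℂ] ℂ) := by
  unfold siegelFormDeriv
  fun_prop

theorem norm_siegelFormDeriv_le (w : Fin n → ℂ) :
    ‖siegelFormDeriv w‖ ≤ 1 + 2 * ∑ j ∈ Finset.univ.erase (0 : Fin n), ‖w j‖ := by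
  have h0 : 0 ≤ ∑ j ∈ Finset.univ.erase (0 : Fin n), ‖w j‖ :=
    Finset.sum_nonneg fun _ _ => norm_nonneg _
  refine ContinuousLinearMap.opNorm_le_bound _ (by positivity) fun x => ?_
  rw [siegelFormDeriv_apply]
  have h1 : ‖∑ j ∈ Finset.univ.erase (0 : Fin n), x j * conj (w j)‖ ≤
      (∑ j ∈ Finset.univ.erase (0 : Fin n), ‖w j‖) * ‖x‖ := by
    rw [Finset.sum_mul]
    refine norm_sum_le_of_le _ fun j _ => ?_
    rw [norm_mul, RCLike.norm_conj, mul_comm]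
    exact mul_le_mul_of_nonneg_left (norm_le_pi_norm x j) (norm_nonneg _)
  calc _ ≤ ‖-Complex.I * x 0‖ +
        ‖2 * ∑ j ∈ Finset.univ.erase (0 : Fin n), x j * conj (w j)‖ := norm_sub_le _ _
    _ ≤ ‖x‖ + 2 * ((∑ j ∈ Finset.univ.erase (0 : Fin n), ‖w j‖) * ‖x‖) := by
        rw [norm_mul, norm_mul, norm_neg, Complex.norm_I, one_mul, Complex.norm_ofNat]
        gcongr
        exact norm_le_pi_norm x 0
    _ = _ := by ring

/-- The derivative grows linearly in `w̃`, whereas the form controls `ρ(z) + |z̃ - w̃|²`; `x ≤ 1 +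
x²` compares the two. -/
theorem exists_norm_siegelFormDeriv_le {z : Fin n → ℂ} (hz : z ∈ siegelDomain n) :
    ∃ C : ℝ, 0 < C ∧ ∀ w ∈ siegelDomain n, ‖siegelFormDeriv w‖ ≤ C * ‖siegelForm z w‖ := by
  have hρ := mem_siegelDomain_iff.1 hz
  set S := Finset.univ.erase (0 : Fin n)
  set A : ℝ := 1 + 2 * ∑ j ∈ S, (‖z j‖ + 1) with hA
  have hA0 : 0 < A := by positivity
  refine ⟨A / siegelRho z + 2, by positivity, fun w hw => ?_⟩
  have hX : 0 ≤ ∑ j ∈ S, ‖z j - w j‖ ^ 2 := Finset.sum_nonneg fun _ _ => sq_nonneg _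
  have hform : siegelRho z + ∑ j ∈ S, ‖z j - w j‖ ^ 2 ≤ ‖siegelForm z w‖ := by
    refine le_trans ?_ (Complex.re_le_norm _)
    rw [siegelForm_re]
    linarith [mem_siegelDomain_iff.1 hw]
  have hsum : ∑ j ∈ S, ‖w j‖ ≤ ∑ j ∈ S, (‖z j‖ + 1) + ∑ j ∈ S, ‖z j - w j‖ ^ 2 := by
    rw [← Finset.sum_add_distrib]
    refine Finset.sum_le_sum fun j _ => ?_
    have h1 : ‖w j‖ ≤ ‖z j‖ + ‖z j - w j‖ := by
      rw [norm_sub_rev]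
      exact norm_le_norm_add_norm_sub' _ _
    nlinarith [sq_nonneg (‖z j - w j‖ - 1)]
  have hAle : A ≤ A / siegelRho z * ‖siegelForm z w‖ := by
    rw [div_mul_eq_mul_div, le_div_iff₀ hρ]
    exact mul_le_mul_of_nonneg_left (by linarith) hA0.le
  calc ‖siegelFormDeriv w‖ ≤ 1 + 2 * ∑ j ∈ S, ‖w j‖ := norm_siegelFormDeriv_le w
    _ ≤ A + 2 * ∑ j ∈ S, ‖z j - w j‖ ^ 2 := by linarith
    _ ≤ A / siegelRho z * ‖siegelForm z w‖ + 2 * ‖siegelForm z w‖ := by linarith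
    _ = _ := by ring

theorem hasFDerivAt_siegelKernel (β : ℝ) {z w : Fin n → ℂ} (hz : z ∈ siegelDomain n)
    (hw : w ∈ siegelDomain n) :
    HasFDerivAt (fun z => siegelKernel β z w)
      ((((-(β + n + 1) : ℝ) : ℂ) * siegelForm z w ^ (((-(β + n + 1) : ℝ) : ℂ) - 1)) •
        siegelFormDeriv w) z := by
  have h : HasDerivAt (fun x : ℂ => x ^ ((-(β + n + 1) : ℝ) : ℂ)) _ (siegelForm z w) :=
    (Complex.hasStrictDerivAt_cpow_const (Or.inl (siegelForm_re_pos hz hw))).hasDerivAt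
  exact h.comp_hasFDerivAt z (hasFDerivAt_siegelForm z w)

/-- Near `z` the derivative of the kernel is dominated, uniformly in `w`, by a multiple of the
kernel at `z` itself, so integrability at `z` already supplies the dominating function. -/
theorem differentiableOn_integral_mul_siegelKernel {β : ℝ} (hβ : 0 ≤ β) {N : Set (Fin n → ℂ)}
    (hN : MeasurableSet N) (hNΩ : N ⊆ siegelDomain n) {a : (Fin n → ℂ) → ℂ}
    (ha : AEStronglyMeasurable a (volume.restrict N))
    (hint : ∀ z ∈ siegelDomain n, IntegrableOn (fun w => a w * siegelKernel β z w) N) :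
    DifferentiableOn ℂ (fun z => ∫ w in N, a w * siegelKernel β z w) (siegelDomain n) := by
  intro z hz
  obtain ⟨C, hC, hCw⟩ := exists_norm_siegelFormDeriv_le hz
  obtain ⟨r, hr, hrΩ⟩ := Metric.isOpen_iff.1 isOpen_siegelDomain z hz
  have hn : (0 : ℝ) ≤ n := Nat.cast_nonneg n
  set p : ℝ := -(β + n + 1) with hp
  have hp0 : p - 1 ≤ 0 := by linarith
  -- The radius `1 / (2C)` keeps `|siegelForm x w|` at least half of `|siegelForm z w|` for every
  -- `w` in the domain.
  set s := Metric.ball z (min r (1 / (2 * C))) with hs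
  have hsΩ : s ⊆ siegelDomain n := (Metric.ball_subset_ball (min_le_left _ _)).trans hrΩ
  set F' : (Fin n → ℂ) → (Fin n → ℂ) → (Fin n → ℂ) →L[ℂ] ℂ := fun x w =>
    a w • (((p : ℂ) * siegelForm x w ^ ((p : ℂ) - 1)) • siegelFormDeriv w) with hF'
  have hbound : ∀ w ∈ siegelDomain n, ∀ x ∈ s,
      ‖F' x w‖ ≤ |p| * (1 / 2 : ℝ) ^ (p - 1) * C * ‖a w * siegelKernel β z w‖ := by
    intro w hw x hx
    have hpos : 0 < ‖siegelForm z w‖ :=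
      (siegelForm_re_pos hz hw).trans_le (Complex.re_le_norm _)
    have hx' : ‖x - z‖ ≤ 1 / (2 * C) :=
      (mem_ball_iff_norm.1 hx).le.trans (min_le_right _ _)
    have hdiff : ‖siegelForm z w‖ - ‖siegelForm x w‖ ≤ 1 / 2 * ‖siegelForm z w‖ := by
      calc ‖siegelForm z w‖ - ‖siegelForm x w‖ ≤ ‖siegelForm z w - siegelForm x w‖ :=
            norm_sub_norm_le _ _
        _ = ‖siegelFormDeriv w (x - z)‖ := by
            rw [norm_sub_rev, siegelForm_eq_siegelFormDeriv, siegelForm_eq_siegelFormDeriv,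
              add_sub_add_right_eq_sub, map_sub]
        _ ≤ ‖siegelFormDeriv w‖ * ‖x - z‖ := ContinuousLinearMap.le_opNorm _ _
        _ ≤ (C * ‖siegelForm z w‖) * (1 / (2 * C)) := by
            gcongr
            exact hCw w hw
        _ = _ := by field_simp
    have hle : 1 / 2 * ‖siegelForm z w‖ ≤ ‖siegelForm x w‖ := by linarith
    have hpow : ‖siegelForm x w ^ ((p : ℂ) - 1)‖ ≤
        (1 / 2 : ℝ) ^ (p - 1) * ‖siegelForm z w‖ ^ (p - 1) := by
      rw [← Complex.ofReal_one, ← Complex.ofReal_sub, Complex.norm_cpow_real,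
        ← Real.mul_rpow (by norm_num) hpos.le]
      exact Real.rpow_le_rpow_of_nonpos (by positivity) hle hp0
    rw [hF', norm_smul, norm_smul, norm_mul, Complex.norm_real, norm_mul, norm_siegelKernel, ← hp,
      Real.norm_eq_abs]
    calc ‖a w‖ * (|p| * ‖siegelForm x w ^ ((p : ℂ) - 1)‖ * ‖siegelFormDeriv w‖)
        ≤ ‖a w‖ * (|p| * ((1 / 2 : ℝ) ^ (p - 1) * ‖siegelForm z w‖ ^ (p - 1)) *
          (C * ‖siegelForm z w‖)) := by
          gcongr
          exact hCw w hw
      _ = |p| * (1 / 2 : ℝ) ^ (p - 1) * C *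
          (‖a w‖ * (‖siegelForm z w‖ ^ (p - 1) * ‖siegelForm z w‖)) := by ring
      _ = _ := by
          rw [← Real.rpow_add_one hpos.ne', sub_add_cancel]
  have hform : Continuous fun w => siegelForm z w := by
    unfold siegelForm
    fun_prop
  refine DifferentiableAt.differentiableWithinAt (HasFDerivAt.differentiableAt
    (hasFDerivAt_integral_of_dominated_of_fderiv_le (𝕜 := ℂ) (s := s) (F' := F')
      (bound := fun w => |p| * (1 / 2 : ℝ) ^ (p - 1) * C * ‖a w * siegelKernel β z w‖)
      (Metric.ball_mem_nhds z (lt_min hr (by positivity))) ?_ (hint z hz) ?_ ?_ ?_ ?_))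
  · exact Filter.Eventually.of_forall fun x =>
      ha.mul (measurable_siegelKernel_right β x).aestronglyMeasurable
  · have hcoef : Measurable fun w => (p : ℂ) * siegelForm z w ^ ((p : ℂ) - 1) :=
      measurable_const.mul (hform.measurable.pow_const _)
    exact ha.fun_smul (hcoef.aestronglyMeasurable.fun_smul
      continuous_siegelFormDeriv.aestronglyMeasurable)
  · filter_upwards [ae_restrict_mem hN] with w hw using hbound w (hNΩ hw)
  · exact (hint z hz).norm.const_mul _
  · filter_upwards [ae_restrict_mem hN] with w hw x hx
    exact (hasFDerivAt_siegelKernel β (hsΩ hx) (hNΩ hw)).const_mul (a w)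

end Holomorphy

/-! ### The two distance estimates. -/

section Main

variable {n : ℕ} [NeZero n]

theorem enorm_mul_siegelWeight_le_siegelSupNorm (t : ℝ) (F : (Fin n → ℂ) → ℂ) {z : Fin n → ℂ}
    (hz : z ∈ siegelDomain n) :
    ‖F z‖ₑ * ENNReal.ofReal (siegelWeight t z) ≤ siegelSupNorm t F :=
  le_iSup₂_of_le z hz le_rfl

theorem ofReal_siegelWeight_add {z : Fin n → ℂ} (hz : z ∈ siegelDomain n) (α β : ℝ) :
    ENNReal.ofReal (siegelWeight (α + β) z) =
      ENNReal.ofReal (siegelWeight α z) * ENNReal.ofReal (siegelWeight β z) := by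
  rw [siegelWeight_add hz, ENNReal.ofReal_mul (siegelWeight_pos hz α).le]

theorem ofReal_siegelWeight_sub_mul {z : Fin n → ℂ} (hz : z ∈ siegelDomain n) (α β : ℝ) :
    ENNReal.ofReal (siegelWeight (α - β) z) * ENNReal.ofReal (siegelWeight β z) =
      ENNReal.ofReal (siegelWeight α z) := by
  rw [← ofReal_siegelWeight_add hz, sub_add_cancel]

theorem enorm_siegelWeight {z : Fin n → ℂ} (hz : z ∈ siegelDomain n) (α : ℝ) :
    ‖(siegelWeight α z : ℂ)‖ₑ = ENNReal.ofReal (siegelWeight α z) := by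
  rw [← ofReal_norm, Complex.norm_real, Real.norm_of_nonneg (siegelWeight_pos hz α).le]

theorem enorm_mul_weight_mul_kernel_le {t β : ℝ} {f : (Fin n → ℂ) → ℂ} {z w : Fin n → ℂ}
    (hw : w ∈ siegelDomain n) {A : ℝ≥0∞} (hA : ‖f w‖ₑ * ENNReal.ofReal (siegelWeight t w) ≤ A) :
    ‖f w * (siegelWeight β w : ℂ) * siegelKernel β z w‖ₑ ≤
      A * (ENNReal.ofReal (siegelWeight (β - t) w) * ‖siegelKernel β z w‖ₑ) := by
  rw [enorm_mul, enorm_mul, enorm_siegelWeight hw, ← ofReal_siegelWeight_sub_mul hw β t]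
  calc _ = (‖f w‖ₑ * ENNReal.ofReal (siegelWeight t w)) *
        (ENNReal.ofReal (siegelWeight (β - t) w) * ‖siegelKernel β z w‖ₑ) := by ring
    _ ≤ _ := by gcongr

theorem measurableSet_siegelLevelSet {f : (Fin n → ℂ) → ℂ}
    (hf : DifferentiableOn ℂ f (siegelDomain n)) (ε s : ℝ) :
    MeasurableSet (siegelLevelSet ε s f) := by
  classical
  -- Nothing is known about `f` off the domain, so it is cut off there before measurability is used.
  have hm : Measurable ((siegelDomain n).indicator f) := by
    rw [← Set.piecewise_eq_indicator]
    exact hf.continuousOn.measurable_piecewise continuousOn_const measurableSet_siegelDomain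
  have : siegelLevelSet ε s f = siegelDomain n ∩
      {z | ε ≤ ‖(siegelDomain n).indicator f z‖ * siegelWeight s z} := by
    ext z
    by_cases hz : z ∈ siegelDomain n <;> simp [siegelLevelSet, hz]
  rw [this]
  exact measurableSet_siegelDomain.inter
    (measurableSet_le measurable_const (hm.norm.mul (measurable_siegelWeight s)))

theorem siegelLevelSet_subset (ε s : ℝ) (f : (Fin n → ℂ) → ℂ) :
    siegelLevelSet ε s f ⊆ siegelDomain n := fun _ h => h.1

theorem integrableOn_mul_weight_mul_kernel {t β : ℝ} (ht : 0 < t) (hβ : t - 1 < β)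
    {f : (Fin n → ℂ) → ℂ} (hf : f ∈ SiegelAInfty n t) {z : Fin n → ℂ} (hz : z ∈ siegelDomain n) :
    IntegrableOn (fun w => f w * (siegelWeight β w : ℂ) * siegelKernel β z w)
      (siegelDomain n) := by
  obtain ⟨I, hI, hFR⟩ := exists_lintegral_weight_mul_kernel_eq (n := n) (s := β - t) (β := β)
    (by linarith) (by linarith)
  refine ⟨?_, ?_⟩
  · refine ((hf.1.continuousOn.aestronglyMeasurable measurableSet_siegelDomain).mul
      ?_).mul (measurable_siegelKernel_right β z).aestronglyMeasurable
    exact (Complex.measurable_ofReal.comp (measurable_siegelWeight β)).aestronglyMeasurable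
  · calc ∫⁻ w in siegelDomain n, ‖f w * (siegelWeight β w : ℂ) * siegelKernel β z w‖ₑ
        ≤ ∫⁻ w in siegelDomain n, siegelSupNorm t f *
          (ENNReal.ofReal (siegelWeight (β - t) w) * ‖siegelKernel β z w‖ₑ) :=
          setLIntegral_mono' measurableSet_siegelDomain fun w hw =>
            enorm_mul_weight_mul_kernel_le hw (enorm_mul_siegelWeight_le_siegelSupNorm t f hw)
      _ = siegelSupNorm t f * (I * ENNReal.ofReal (siegelWeight (β - t - β) z)) := by
          rw [lintegral_const_mul' _ _ hf.2.ne, hFR z hz]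
      _ < ∞ := ENNReal.mul_lt_top hf.2 (ENNReal.mul_lt_top hI ENNReal.ofReal_lt_top)

/-- The approximant is the part of the reproducing integral over the level set; the remainder sees
only points where `|f| γ_t < ε`. -/
theorem exists_siegelL1_le {t ν β : ℝ} (ht : 0 < t) (hβ0 : 0 ≤ β) (hβ : t - 1 < β) :
    ∃ C : ℝ, 0 < C ∧ ∀ f ∈ SiegelAInfty n t, ∀ ε : ℝ, 0 < ε → siegelG t ν β ε f < ∞ →
      siegelL1 t ν f ≤ ENNReal.ofReal C * ENNReal.ofReal ε := by
  obtain ⟨I, hI, hFR⟩ := exists_lintegral_weight_mul_kernel_eq (n := n) (s := β - t) (β := β)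
    (by linarith) (by linarith)
  set M := reproducingConst (n - 1) β with hM
  have hM0 : 0 < M := reproducingConst_pos (n - 1) hβ0
  have hMc : (M : ℂ) ≠ 0 := by exact_mod_cast hM0.ne'
  have hMe : ‖(M : ℂ)⁻¹‖ₑ = ENNReal.ofReal M⁻¹ := by
    rw [← ofReal_norm, norm_inv, Complex.norm_real, Real.norm_of_nonneg hM0.le]
  -- The summand `1` gives positivity without proving that `I` is nonzero.
  refine ⟨M⁻¹ * I.toReal + 1, by positivity, fun f hf ε hε hG => ?_⟩
  set N := siegelLevelSet ε t f with hN
  have hNm : MeasurableSet N := measurableSet_siegelLevelSet hf.1 ε t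
  have hNΩ : N ⊆ siegelDomain n := siegelLevelSet_subset ε t f
  set φ : (Fin n → ℂ) → (Fin n → ℂ) → ℂ := fun z w =>
    f w * (siegelWeight β w : ℂ) * siegelKernel β z w with hφ
  have hint : ∀ z ∈ siegelDomain n, IntegrableOn (φ z) (siegelDomain n) := fun z hz =>
    integrableOn_mul_weight_mul_kernel ht hβ hf hz
  set g : (Fin n → ℂ) → ℂ := fun z => (M : ℂ)⁻¹ * ∫ w in N, φ z w with hg
  have hgd : DifferentiableOn ℂ g (siegelDomain n) := by
    refine DifferentiableOn.const_mul ?_ _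
    refine differentiableOn_integral_mul_siegelKernel hβ0 hNm hNΩ
      (a := fun w => f w * (siegelWeight β w : ℂ)) ?_ fun z hz => (hint z hz).mono_set hNΩ
    refine AEStronglyMeasurable.mul ?_
      (Complex.measurable_ofReal.comp (measurable_siegelWeight β)).aestronglyMeasurable
    exact (hf.1.continuousOn.mono hNΩ).aestronglyMeasurable hNm
  have hgb : ∀ z ∈ siegelDomain n, ‖g z‖ₑ ≤ ENNReal.ofReal M⁻¹ * siegelSupNorm t f *
      ∫⁻ w in N, ENNReal.ofReal (siegelWeight (β - t) w) * ‖siegelKernel β z w‖ₑ := by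
    intro z hz
    rw [hg, enorm_mul, hMe, mul_assoc, ← lintegral_const_mul' _ _ hf.2.ne]
    gcongr
    refine (enorm_integral_le_lintegral_enorm _).trans (setLIntegral_mono' hNm fun w hw => ?_)
    exact enorm_mul_weight_mul_kernel_le (hNΩ hw)
      (enorm_mul_siegelWeight_le_siegelSupNorm t f (hNΩ hw))
  have hgB : g ∈ SiegelBergman n ν := by
    refine ⟨hgd, ?_⟩
    have hc : ENNReal.ofReal M⁻¹ * siegelSupNorm t f ≠ ∞ :=
      ENNReal.mul_ne_top ENNReal.ofReal_ne_top hf.2.ne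
    calc ∫⁻ z in siegelDomain n, ‖g z‖ₑ ^ 2 * ENNReal.ofReal (siegelWeight ν z)
        ≤ ∫⁻ z in siegelDomain n, (ENNReal.ofReal M⁻¹ * siegelSupNorm t f) ^ 2 *
          ((∫⁻ w in N, ENNReal.ofReal (siegelWeight (β - t) w) * ‖siegelKernel β z w‖ₑ) ^ 2 *
            ENNReal.ofReal (siegelWeight ν z)) := by
          refine setLIntegral_mono' measurableSet_siegelDomain fun z hz => ?_
          rw [← mul_assoc, ← mul_pow]
          gcongr
          exact hgb z hz
      _ = (ENNReal.ofReal M⁻¹ * siegelSupNorm t f) ^ 2 * siegelG t ν β ε f :=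
          lintegral_const_mul' _ _ (ENNReal.pow_ne_top hc)
      _ < ∞ := ENNReal.mul_lt_top (ENNReal.pow_lt_top hc.lt_top) hG
  refine (iInf₂_le g hgB).trans (iSup₂_le fun z hz => ?_)
  have hdiff : f z - g z = (M : ℂ)⁻¹ * ∫ w in siegelDomain n \ N, φ z w := by
    have h1 := integral_mul_kernel hβ0 hf.1 hz (hint z hz)
    have h2 : (∫ w in siegelDomain n \ N, φ z w) + ∫ w in N, φ z w =
        ∫ w in siegelDomain n, φ z w := by
      rw [setIntegral_sdiff hNm (hint z hz) hNΩ, sub_add_cancel]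
    rw [h1] at h2
    rw [hg, ← mul_right_inj' hMc, mul_sub, mul_inv_cancel_left₀ hMc, mul_inv_cancel_left₀ hMc,
      ← h2, add_sub_cancel_right]
  have hsmall : ∫⁻ w in siegelDomain n \ N, ‖φ z w‖ₑ ≤
      ENNReal.ofReal ε * (I * ENNReal.ofReal (siegelWeight (β - t - β) z)) := by
    rw [← hFR z hz, ← lintegral_const_mul' _ _ ENNReal.ofReal_ne_top]
    refine (setLIntegral_mono' (measurableSet_siegelDomain.diff hNm) fun w hw => ?_).trans
      (lintegral_mono_set Set.sdiff_subset)
    refine enorm_mul_weight_mul_kernel_le hw.1 ?_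
    rw [← ofReal_norm, ← ENNReal.ofReal_mul (norm_nonneg _)]
    exact ENNReal.ofReal_le_ofReal (not_le.1 fun h => hw.2 ⟨hw.1, h⟩).le
  have hone : ENNReal.ofReal (siegelWeight (β - t - β) z) * ENNReal.ofReal (siegelWeight t z) =
      1 := by
    rw [← ofReal_siegelWeight_add hz, show β - t - β + t = 0 by ring, siegelWeight, Real.rpow_zero,
      ENNReal.ofReal_one]
  calc ‖f z - g z‖ₑ * ENNReal.ofReal (siegelWeight t z)
      ≤ (ENNReal.ofReal M⁻¹ * (ENNReal.ofReal ε *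
        (I * ENNReal.ofReal (siegelWeight (β - t - β) z)))) * ENNReal.ofReal (siegelWeight t z) := by
        rw [hdiff, enorm_mul, hMe]
        gcongr
        exact (enorm_integral_le_lintegral_enorm _).trans hsmall
    _ = ENNReal.ofReal M⁻¹ * I * ENNReal.ofReal ε *
        (ENNReal.ofReal (siegelWeight (β - t - β) z) * ENNReal.ofReal (siegelWeight t z)) := by
        ring
    _ = ENNReal.ofReal (M⁻¹ * I.toReal) * ENNReal.ofReal ε := by
        rw [hone, mul_one, ENNReal.ofReal_mul (by positivity), ENNReal.ofReal_toReal hI.ne]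
    _ ≤ _ := by
        gcongr
        linarith

theorem lintegral_mul_sq_le {α : Type*} [MeasurableSpace α] (μ : Measure α) {u v : α → ℝ≥0∞}
    (hu : AEMeasurable u μ) (hv : AEMeasurable v μ) :
    (∫⁻ x, u x * v x ∂μ) ^ 2 ≤ (∫⁻ x, u x ^ 2 ∂μ) * ∫⁻ x, v x ^ 2 ∂μ := by
  have h := ENNReal.lintegral_mul_le_Lp_mul_Lq μ Real.HolderConjugate.two_two hu hv
  have h2 : ∀ x : ℝ≥0∞, (x ^ (1 / 2 : ℝ)) ^ 2 = x := fun x => by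
    rw [← ENNReal.rpow_natCast, ← ENNReal.rpow_mul]
    norm_num
  calc (∫⁻ x, u x * v x ∂μ) ^ 2 ≤ _ := pow_le_pow_left' h 2
    _ = _ := by
      rw [mul_pow, h2, h2]
      simp only [ENNReal.rpow_ofNat]

/-- Schur's test: the positive Bergman operator is bounded on the weighted `L²` space. -/
theorem lintegral_sq_lintegral_weight_mul_kernel_lt_top {ν β : ℝ} (hν : -1 < ν)
    (hβ : (ν + 1) / 2 ≤ β) {g : (Fin n → ℂ) → ℂ} (hg : g ∈ SiegelBergman n ν) :
    ∫⁻ z in siegelDomain n,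
      (∫⁻ w in siegelDomain n,
        ENNReal.ofReal (siegelWeight β w) * ‖siegelKernel β z w‖ₑ * ‖g w‖ₑ) ^ 2
        * ENNReal.ofReal (siegelWeight ν z) < ∞ := by
  -- The Schur test function is `γ_{-a}`. The midpoint of `0 < a < ν + 1` is taken: `a > 0` serves
  -- the integral in `w`, and `ν - a > -1` the one in `z`.
  set a := (ν + 1) / 2 with ha
  have ha0 : 0 < a := by linarith
  obtain ⟨I, hI, hFR⟩ := exists_lintegral_weight_mul_kernel_eq (n := n) (s := β - a) (β := β)
    (by linarith) (by linarith)
  obtain ⟨J, hJ, hFR'⟩ := exists_lintegral_weight_mul_kernel_eq (n := n) (s := ν - a) (β := β)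
    (by linarith) (by linarith)
  have hgm : AEMeasurable (fun w => ‖g w‖ₑ) (volume.restrict (siegelDomain n)) :=
    (hg.1.continuousOn.aemeasurable measurableSet_siegelDomain).enorm
  have hroot : ∀ x : ℝ≥0∞, (x ^ (1 / 2 : ℝ)) ^ 2 = x := fun x => by
    rw [← ENNReal.rpow_natCast, ← ENNReal.rpow_mul]
    norm_num
  have hcs : ∀ z ∈ siegelDomain n,
      (∫⁻ w in siegelDomain n,
        ENNReal.ofReal (siegelWeight β w) * ‖siegelKernel β z w‖ₑ * ‖g w‖ₑ) ^ 2 ≤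
      I * ENNReal.ofReal (siegelWeight (-a) z) * ∫⁻ w in siegelDomain n,
        ENNReal.ofReal (siegelWeight (β + a) w) * ‖siegelKernel β z w‖ₑ * ‖g w‖ₑ ^ 2 := by
    intro z hz
    have hk := (measurable_siegelKernel_right β z).enorm
    set u : (Fin n → ℂ) → ℝ≥0∞ := fun w =>
      (ENNReal.ofReal (siegelWeight (β - a) w) * ‖siegelKernel β z w‖ₑ) ^ (1 / 2 : ℝ) with hu
    set v : (Fin n → ℂ) → ℝ≥0∞ := fun w =>
      (ENNReal.ofReal (siegelWeight (β + a) w) * ‖siegelKernel β z w‖ₑ) ^ (1 / 2 : ℝ) *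
        ‖g w‖ₑ with hv
    have hum : Measurable u :=
      ((measurable_siegelWeight _).ennreal_ofReal.mul hk).pow_const _
    have hvm : AEMeasurable v (volume.restrict (siegelDomain n)) :=
      (((measurable_siegelWeight _).ennreal_ofReal.mul hk).pow_const _).aemeasurable.mul hgm
    -- Cauchy–Schwarz with the weight split as `γ_{β-a}` and `γ_{β+a}`; the first factor is then
    -- evaluated by Forelli–Rudin.
    have huv : ∀ w ∈ siegelDomain n, ENNReal.ofReal (siegelWeight β w) * ‖siegelKernel β z w‖ₑ *
        ‖g w‖ₑ = u w * v w := by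
      intro w hw
      have hw2 : ENNReal.ofReal (siegelWeight (β - a) w) * ENNReal.ofReal (siegelWeight (β + a) w)
          = ENNReal.ofReal (siegelWeight β w) ^ 2 := by
        rw [← ofReal_siegelWeight_add hw, sq, ← ofReal_siegelWeight_add hw]
        congr 2
        ring
      rw [hu, hv]
      simp only
      rw [← mul_assoc, ← ENNReal.mul_rpow_of_nonneg _ _ (by norm_num),
        mul_mul_mul_comm, hw2, ← sq, ← mul_pow, ← ENNReal.rpow_natCast, ← ENNReal.rpow_mul]
      norm_num
    rw [setLIntegral_congr_fun measurableSet_siegelDomain huv]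
    refine (lintegral_mul_sq_le _ hum.aemeasurable hvm).trans (le_of_eq ?_)
    simp only [hu, hv, mul_pow, hroot]
    rw [hFR z hz, show β - a - β = -a by ring]
  have hmeas : AEMeasurable (Function.uncurry fun z w : Fin n → ℂ =>
      ENNReal.ofReal (siegelWeight (ν - a) z) *
        (ENNReal.ofReal (siegelWeight (β + a) w) * ‖siegelKernel β z w‖ₑ * ‖g w‖ₑ ^ 2))
      ((volume.restrict (siegelDomain n)).prod (volume.restrict (siegelDomain n))) := by
    refine AEMeasurable.mul (M := ℝ≥0∞) ?_ (AEMeasurable.mul (M := ℝ≥0∞)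
      (AEMeasurable.mul (M := ℝ≥0∞) ?_ ?_) ?_)
    · exact ((measurable_siegelWeight _).ennreal_ofReal.comp measurable_fst).aemeasurable
    · exact ((measurable_siegelWeight _).ennreal_ofReal.comp measurable_snd).aemeasurable
    · exact (measurable_siegelKernel_uncurry β).enorm.aemeasurable
    · exact (hgm.comp_snd).pow_const 2
  have hsq := hg.2
  calc _ ≤ ∫⁻ z in siegelDomain n, I * ∫⁻ w in siegelDomain n,
        ENNReal.ofReal (siegelWeight (ν - a) z) *
        (ENNReal.ofReal (siegelWeight (β + a) w) * ‖siegelKernel β z w‖ₑ * ‖g w‖ₑ ^ 2) := by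
        refine setLIntegral_mono' measurableSet_siegelDomain fun z hz => ?_
        rw [lintegral_const_mul' _ _ ENNReal.ofReal_ne_top, sub_eq_add_neg ν a,
          ofReal_siegelWeight_add hz]
        calc _ ≤ _ := mul_le_mul_left (hcs z hz) _
          _ = _ := by ring
    -- After Tonelli, symmetry of `|B_β|` lets Forelli–Rudin evaluate the integral in `z`; the
    -- exponents `β + a` and `ν - a - β` add up to `ν`.
    _ = I * ∫⁻ w in siegelDomain n, ∫⁻ z in siegelDomain n,
        ENNReal.ofReal (siegelWeight (ν - a) z) *
        (ENNReal.ofReal (siegelWeight (β + a) w) * ‖siegelKernel β z w‖ₑ * ‖g w‖ₑ ^ 2) := by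
        rw [lintegral_const_mul' _ _ hI.ne, lintegral_lintegral_swap hmeas]
    _ = I * ∫⁻ w in siegelDomain n, J * (‖g w‖ₑ ^ 2 * ENNReal.ofReal (siegelWeight ν w)) := by
        congr 1
        refine setLIntegral_congr_fun measurableSet_siegelDomain fun w hw => ?_
        have hfin : ENNReal.ofReal (siegelWeight (β + a) w) * ‖g w‖ₑ ^ 2 ≠ ∞ :=
          ENNReal.mul_ne_top ENNReal.ofReal_ne_top (ENNReal.pow_ne_top enorm_ne_top)
        calc _ = ∫⁻ z in siegelDomain n, (ENNReal.ofReal (siegelWeight (β + a) w) * ‖g w‖ₑ ^ 2) *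
              (ENNReal.ofReal (siegelWeight (ν - a) z) * ‖siegelKernel β w z‖ₑ) := by
              refine lintegral_congr fun z => ?_
              rw [enorm_siegelKernel_comm β z w]
              ring
          _ = (ENNReal.ofReal (siegelWeight (β + a) w) * ‖g w‖ₑ ^ 2) *
              (J * ENNReal.ofReal (siegelWeight (ν - a - β) w)) := by
              rw [lintegral_const_mul' _ _ hfin, hFR' w hw]
          _ = J * (‖g w‖ₑ ^ 2 * (ENNReal.ofReal (siegelWeight (β + a) w) *
              ENNReal.ofReal (siegelWeight (ν - a - β) w))) := by ring
          _ = _ := by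
              rw [← ofReal_siegelWeight_add hw, show β + a + (ν - a - β) = ν by ring]
    _ = I * (J * ∫⁻ w in siegelDomain n, ‖g w‖ₑ ^ 2 * ENNReal.ofReal (siegelWeight ν w)) := by
        rw [lintegral_const_mul' _ _ hJ.ne]
    _ < ∞ := ENNReal.mul_lt_top hI (ENNReal.mul_lt_top hJ hsq)

/-- On the level set `|g| γ_t ≥ ε - δ`, so the level-set integral is at most `(ε - δ)⁻¹` times the
positive Bergman operator applied to `|g|`. -/
theorem siegelG_lt_top_of_mem_siegelBergman {t ν β : ℝ} (hν : -1 < ν) (hβ : (ν + 1) / 2 ≤ β)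
    {f g : (Fin n → ℂ) → ℂ} (hf : f ∈ SiegelAInfty n t) (hg : g ∈ SiegelBergman n ν)
    (hfin : siegelSupNorm t (fun z => f z - g z) ≠ ∞) {ε : ℝ}
    (hε : (siegelSupNorm t (fun z => f z - g z)).toReal < ε) : siegelG t ν β ε f < ∞ := by
  set δ := (siegelSupNorm t (fun z => f z - g z)).toReal with hδ
  set N := siegelLevelSet ε t f with hN
  have hNm : MeasurableSet N := measurableSet_siegelLevelSet hf.1 ε t
  have hη : 0 < ε - δ := sub_pos.2 hε
  have hle : ∀ w ∈ N, siegelWeight (β - t) w ≤ (ε - δ)⁻¹ * (siegelWeight β w * ‖g w‖) := by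
    intro w hw
    have hsup : ‖f w - g w‖ * siegelWeight t w ≤ δ := by
      have h := enorm_mul_siegelWeight_le_siegelSupNorm t (fun z => f z - g z) hw.1
      rw [← ofReal_norm, ← ENNReal.ofReal_mul (norm_nonneg _)] at h
      exact (ENNReal.ofReal_le_iff_le_toReal hfin).1 h
    have hwt := siegelWeight_pos hw.1 t
    have hg1 : ε - δ ≤ ‖g w‖ * siegelWeight t w := by
      have h1 : ‖f w‖ ≤ ‖f w - g w‖ + ‖g w‖ := by
        simpa using norm_add_le (f w - g w) (g w)
      have h2 := hw.2
      nlinarith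
    rw [le_inv_mul_iff₀ hη]
    have hadd := siegelWeight_add hw.1 (β - t) t
    rw [sub_add_cancel] at hadd
    rw [hadd]
    nlinarith [mul_le_mul_of_nonneg_left hg1 (siegelWeight_pos hw.1 (β - t)).le]
  have hinner : ∀ z, ∫⁻ w in N, ENNReal.ofReal (siegelWeight (β - t) w) * ‖siegelKernel β z w‖ₑ ≤
      ENNReal.ofReal (ε - δ)⁻¹ * ∫⁻ w in siegelDomain n,
        ENNReal.ofReal (siegelWeight β w) * ‖siegelKernel β z w‖ₑ * ‖g w‖ₑ := by
    intro z
    rw [← lintegral_const_mul' _ _ ENNReal.ofReal_ne_top]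
    refine (setLIntegral_mono' hNm fun w hw => ?_).trans
      (lintegral_mono_set (siegelLevelSet_subset ε t f))
    calc _ ≤ ENNReal.ofReal ((ε - δ)⁻¹ * (siegelWeight β w * ‖g w‖)) * ‖siegelKernel β z w‖ₑ := by
          gcongr
          exact hle w hw
      _ = _ := by
          rw [ENNReal.ofReal_mul (inv_pos.2 hη).le, ENNReal.ofReal_mul (siegelWeight_pos hw.1 _).le,
            ofReal_norm]
          ring
  calc siegelG t ν β ε f ≤ ∫⁻ z in siegelDomain n, ENNReal.ofReal (ε - δ)⁻¹ ^ 2 *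
        ((∫⁻ w in siegelDomain n,
          ENNReal.ofReal (siegelWeight β w) * ‖siegelKernel β z w‖ₑ * ‖g w‖ₑ) ^ 2
            * ENNReal.ofReal (siegelWeight ν z)) := by
        refine lintegral_mono fun z => ?_
        rw [← mul_assoc, ← mul_pow]
        gcongr
        exact hinner z
    _ = ENNReal.ofReal (ε - δ)⁻¹ ^ 2 * _ :=
        lintegral_const_mul' _ _ (ENNReal.pow_ne_top ENNReal.ofReal_ne_top)
    _ < ∞ := ENNReal.mul_lt_top (ENNReal.pow_lt_top ENNReal.ofReal_lt_top)
        (lintegral_sq_lintegral_weight_mul_kernel_lt_top hν hβ hg)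

theorem siegelL2_le_siegelL1 {t ν β : ℝ} (hν : -1 < ν) (hβ : (ν + 1) / 2 ≤ β)
    {f : (Fin n → ℂ) → ℂ} (hf : f ∈ SiegelAInfty n t) :
    siegelL2 t ν β f ≤ siegelL1 t ν f := by
  -- Only `g` at finite distance matters; then `distance + η` is admissible for every `η > 0`.
  refine le_iInf₂ fun g hg => ENNReal.le_of_forall_pos_le_add fun η hη hfin => ?_
  have hpos : 0 < (siegelSupNorm t (fun z => f z - g z)).toReal + η := by positivity
  refine (iInf₂_le ((siegelSupNorm t (fun z => f z - g z)).toReal + η) ⟨hpos,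
    siegelG_lt_top_of_mem_siegelBergman hν hβ hf hg hfin.ne (by simpa using hη)⟩).trans
      (le_of_eq ?_)
  rw [ENNReal.ofReal_add ENNReal.toReal_nonneg η.coe_nonneg, ENNReal.ofReal_toReal hfin.ne,
    ENNReal.ofReal_coe_nnreal]

end Main

/-! ### Assembly of the two inequalities. -/

theorem theorem1 (n : ℕ) [NeZero n] (ν t : ℝ) (hν : -1 < ν) (ht : t = (ν + 1 + (n : ℝ)) / 2) :
    ∃ β₀ : ℝ, 0 < β₀ ∧ ∀ β : ℝ, β₀ < β →
      ∃ c C : ℝ, 0 < c ∧ 0 < C ∧ ∀ f ∈ SiegelAInfty n t,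
        ENNReal.ofReal c * siegelL2 t ν β f ≤ siegelL1 t ν f ∧
        siegelL1 t ν f ≤ ENNReal.ofReal C * siegelL2 t ν β f := by
  have hn : (0 : ℝ) ≤ n := Nat.cast_nonneg n
  have ht0 : 0 < t := by linarith
  -- Since `t = (ν + 1 + n) / 2`, the condition `β > t` implies `β ≥ 0`, `β > t - 1` and `β ≥ (ν +
  -- 1) / 2`.
  refine ⟨t, ht0, fun β hβ => ?_⟩
  obtain ⟨C, hC, hCf⟩ := exists_siegelL1_le (n := n) (ν := ν) ht0 (ht0.trans hβ).le
    (by linarith : t - 1 < β)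
  refine ⟨1, C, one_pos, hC, fun f hf => ⟨?_, ?_⟩⟩
  · rw [ENNReal.ofReal_one, one_mul]
    exact siegelL2_le_siegelL1 hν (by linarith) hf
  · rw [siegelL2, ENNReal.mul_iInf_of_ne (ENNReal.ofReal_pos.2 hC).ne' ENNReal.ofReal_ne_top]
    refine le_iInf fun ε => ?_
    rw [ENNReal.mul_iInf_of_ne (ENNReal.ofReal_pos.2 hC).ne' ENNReal.ofReal_ne_top]
    exact le_iInf fun hε => hCf f hf ε hε.1 hε.2
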